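/- **Theorem.** There are absolute constants $C>0$ and $D,c\in\mathbb N$ and a single deterministic algorithm with the following property. Let $n,k$ be integers with $2\le k\le n$, let $\delta\in(0,1)$ be real, and let $\rho=a/b$ (with $a,b$ positive integers) be a rational number with $\rho\le\delta\le 2\rho$ (for rational $\delta$ one may take $\rho=\delta$). On input $(n,k,a,b)$ the algorithm halts after at most $D\,(n+k)^c$ steps and outputs a measurement matrix $M\in\mathbb R^{m\times n}$ with $$m\le C\,k\,\frac{\log n}{\log k}\,\log\frac{n}{\delta}$$ rows for which there is a decoding function $f:\{-1,0,1\}^m\to\mathcal P(\{1,\dots,n\})$ such that $$\Pr\bigl[f(\operatorname{sign}(M\mathbf x))=\operatorname{supp}(\mathbf x)\bigr]\ge 1-\delta .$$ Here $\mathbf x\in\mathbb R^n$ is random: first a set $S\subseteq\{1,\dots,n\}$ of size $k$ is chosen uniformly among all $\binom nk$ such sets, then $\mathbf x$ is chosen uniformly on the unit sphere of the vectors supported on $S$; $\operatorname{supp}(\mathbf x)=\{i:\mathbf x_i\ne0\}$, and $\operatorname{sign}$ is applied entrywise with values $1,-1,0$ for positive, negative and zero arguments. Algorithms are programs of a random access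 machine with natural-number registers and arrays, whose unit-cost instructions are constants, addition, truncated subtraction, indirect load and store, and comparison tests. (This model and Turing machines simulate each other with polynomial overhead.) -/

import Mathlib

open MeasureTheory
open scoped Matrix

/-! ### Random sparse signals and support recovery from sign measurements -/

noncomputable section

/-- The uniform probability measure on the unit sphere of `ℝ^ι` (normalised surface measure),
as a measure on the whole space `ℝ^ι`. -/
def sphereLaw (ι : Type) [Fintype ι] : Measure (EuclideanSpace ℝ ι) :=
  Measure.map Subtype.val
    (((volume : Measure (EuclideanSpace ℝ ι)).toSphere Set.univ)⁻¹ •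
      (volume : Measure (EuclideanSpace ℝ ι)).toSphere)

/-- Extension by zero of a vector indexed by `S ⊆ [n]` to a vector indexed by `[n]`. -/
def extendZero {n : ℕ} (S : Finset (Fin n)) (y : EuclideanSpace ℝ S) : EuclideanSpace ℝ (Fin n) :=
  WithLp.toLp 2 fun i => if h : i ∈ S then y ⟨i, h⟩ else 0

/-- The law of the random signal: first a set `S` of `k` indices is chosen uniformly at random,
then a uniformly random unit vector on the coordinates in `S`. -/
def signalLaw (n k : ℕ) : Measure (EuclideanSpace ℝ (Fin n)) :=
  ((n.choose k : ENNReal)⁻¹) •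
    ∑ S ∈ (Finset.univ : Finset (Fin n)).powersetCard k, (sphereLaw S).map (extendZero S)

/-- The set of indices of the nonzero components. -/
def signalSupport {n : ℕ} (x : EuclideanSpace ℝ (Fin n)) : Set (Fin n) := {i | x i ≠ 0}

/-- The sign measurements `sign (M x) ∈ {-1, 0, 1}^m`. -/
def signMeasurements {m n : ℕ} (M : Matrix (Fin m) (Fin n) ℝ) (x : EuclideanSpace ℝ (Fin n)) :
    Fin m → SignType :=
  fun i => SignType.sign ((M *ᵥ x.ofLp) i)

/-- Some decoding function determines the support of the random signal from its sign measurements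
with probability at least `1 - δ`. -/
def RecoversRandomSupport {m n : ℕ} (M : Matrix (Fin m) (Fin n) ℝ) (k : ℕ) (δ : ℝ) : Prop :=
  ∃ f : (Fin m → SignType) → Set (Fin n),
    ENNReal.ofReal (1 - δ) ≤ signalLaw n k {x | f (signMeasurements M x) = signalSupport x}

end

/-! ### Algorithms: random access machines with a step count

Programs work on natural-number registers and natural-number arrays, each program using only
finitely many of them. The arithmetic is addition and truncated subtraction at unit cost, without
multiplication, so that this machine and Turing machines simulate each other with polynomial
overhead. -/

namespace RAM

/-- The contents of the registers and of the arrays: `mem a i` is the cell `i` of the array `a`. -/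
structure Store where
  reg : ℕ → ℕ
  mem : ℕ → ℕ → ℕ

/-- `r[x] := v`. -/
def Store.setReg (s : Store) (x v : ℕ) : Store :=
  { s with reg := Function.update s.reg x v }

/-- `a[i] := v`. -/
def Store.setMem (s : Store) (a i v : ℕ) : Store :=
  { s with mem := Function.update s.mem a (Function.update (s.mem a) i v) }

/-- Programs. All arguments of type `ℕ` are literals in the text of the program: names of registers
(`x`, `y`, `z`), names of arrays (`a`), or constants (`v`). -/
inductive Prog : Type
  | skip : Prog
  /-- `r[x] := v` -/
  | const (x v : ℕ) : Prog
  /-- `r[x] := r[y] + r[z]` -/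
  | add (x y z : ℕ) : Prog
  /-- `r[x] := max (r[y] - r[z]) 0` -/
  | sub (x y z : ℕ) : Prog
  /-- `r[x] := a[r[y]]` -/
  | load (x a y : ℕ) : Prog
  /-- `a[r[x]] := r[y]` -/
  | store (a x y : ℕ) : Prog
  | seq (p q : Prog) : Prog
  /-- `if r[x] < r[y] then p else q` -/
  | ifLt (x y : ℕ) (p q : Prog) : Prog
  /-- `while r[x] < r[y] do p` -/
  | whileLt (x y : ℕ) (p : Prog) : Prog

/-- `Exec p s t s'`: started in `s`, the program `p` halts in `s'` after exactly `t` steps.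
Every elementary instruction and every evaluation of a test is one step. -/
inductive Exec : Prog → Store → ℕ → Store → Prop
  | skip (s : Store) : Exec .skip s 1 s
  | const (s : Store) (x v : ℕ) : Exec (.const x v) s 1 (s.setReg x v)
  | add (s : Store) (x y z : ℕ) : Exec (.add x y z) s 1 (s.setReg x (s.reg y + s.reg z))
  | sub (s : Store) (x y z : ℕ) : Exec (.sub x y z) s 1 (s.setReg x (s.reg y - s.reg z))
  | load (s : Store) (x a y : ℕ) : Exec (.load x a y) s 1 (s.setReg x (s.mem a (s.reg y)))
  | store (s : Store) (a x y : ℕ) : Exec (.store a x y) s 1 (s.setMem a (s.reg x) (s.reg y))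
  | seq {p q : Prog} {s₁ s₂ s₃ : Store} {t₁ t₂ : ℕ} (hp : Exec p s₁ t₁ s₂)
      (hq : Exec q s₂ t₂ s₃) : Exec (.seq p q) s₁ (t₁ + t₂) s₃
  | ifTrue {x y : ℕ} {p q : Prog} {s s' : Store} {t : ℕ} (h : s.reg x < s.reg y)
      (hp : Exec p s t s') : Exec (.ifLt x y p q) s (t + 1) s'
  | ifFalse {x y : ℕ} {p q : Prog} {s s' : Store} {t : ℕ} (h : ¬ s.reg x < s.reg y)
      (hq : Exec q s t s') : Exec (.ifLt x y p q) s (t + 1) s'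
  | whileTrue {x y : ℕ} {p : Prog} {s₁ s₂ s₃ : Store} {t₁ t₂ : ℕ} (h : s₁.reg x < s₁.reg y)
      (hp : Exec p s₁ t₁ s₂) (hw : Exec (.whileLt x y p) s₂ t₂ s₃) :
      Exec (.whileLt x y p) s₁ (t₁ + t₂ + 1) s₃
  | whileFalse {x y : ℕ} {p : Prog} {s : Store} (h : ¬ s.reg x < s.reg y) :
      Exec (.whileLt x y p) s 1 s

/-- The initial store: the inputs are in the registers `0, 1, 2, …`, everything else is zero. -/
def inputStore (inputs : List ℕ) : Store where
  reg := fun x => inputs.getD x 0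
  mem := fun _ _ => 0

/-- The number of rows of the matrix that a final store represents is in register `0`. -/
def outputRows (s : Store) : ℕ := s.reg 0

/-- The matrix with `n` columns that a final store represents: its entries are listed row by row
in the array `0`. -/
def outputMatrix (n : ℕ) (s : Store) : Matrix (Fin (outputRows s)) (Fin n) ℝ :=
  Matrix.of fun i j => (s.mem 0 (i.val * n + j.val) : ℝ)

end RAM

namespace RAM

/-! ### A language of bounded loops, compiled to random access machines -/

/-! The matrix comes from a code of `n` columns and length `2 * t` over `16 * k` symbols: the row
`(l, z)` is the indicator of the columns with symbol `z` at position `l`. If `S` does not cover a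
column `j ∉ S`, that is, at some position no column of `S` has the symbol of `j`, then some row
contains `j` and misses `S`. Almost surely no nonempty subset sum of the nonzero entries of the
signal vanishes, so a measurement is zero exactly when its row misses the support, and the signs
determine `S` (`recoversRandomSupport_of_disjunct`).

It remains that few `k`-sets cover another column. If `S` covers `j`, the agreements of its columns
with `j` sum to at least the length, so `2 ^ (2 * t)` is at most the product over `S` of `2 ^
(agreements)`. Averaged over all `S` this product is an elementary symmetric mean, at most the
`k`-th power of the arithmetic mean by Maclaurin (`elemSymm_le`). If every column has average weight
about `(1 + 1 / (16 * k)) ^ (2 * t)`, the `k`-th power is at most `2 ^ t`. A union bound leaves a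
fraction `n / 2 ^ t` of bad sets (`card_covered_le`), and `t` is about the binary logarithm of `n /
δ`.

Such a code is found greedily by conditional expectations: each symbol is the one least shared with
the earlier columns, weighted by `2 ^ (agreements so far)`, so each position multiplies the total
weight by at most `1 + 1 / q` (`chooseSymbol_spec`, `columnLoop_spec`). This controls a column only
against earlier ones; hence `2 * n` columns are built and `n` of them kept whose weight against all
others is at most twice the average (`le_card_filter_mul_le_sum`, `construct_spec`).

The program is written with bounded loops, whose semantics is a function and whose cost is
polynomial in the loop bounds (`exec_compile`, `exists_cost_le`). -/

@[simp] theorem Store.reg_setReg (s : Store) (x v y : ℕ) :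
    (s.setReg x v).reg y = if y = x then v else s.reg y := by
  simp [Store.setReg, Function.update_apply]

@[simp] theorem Store.mem_setReg (s : Store) (x v : ℕ) : (s.setReg x v).mem = s.mem := rfl

@[simp] theorem Store.reg_setMem (s : Store) (a i v : ℕ) : (s.setMem a i v).reg = s.reg := rfl

@[simp] theorem Store.mem_setMem (s : Store) (a i v b j : ℕ) :
    (s.setMem a i v).mem b j = if b = a then if j = i then v else s.mem b j else s.mem b j := by
  by_cases h : b = a
  · subst h; simp [Store.setMem, Function.update_apply]
  · simp [Store.setMem, h]

/-- Programs with bounded loops. -/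
inductive Cmd : Type
  | skip : Cmd
  | const (x v : ℕ) : Cmd
  | add (x y z : ℕ) : Cmd
  | load (x a y : ℕ) : Cmd
  | store (a x y : ℕ) : Cmd
  | seq (p q : Cmd) : Cmd
  | ifLt (x y : ℕ) (p q : Cmd) : Cmd
  /-- `for r[x] = 0, …, r[y] - 1 do p` -/
  | loop (x y : ℕ) (p : Cmd) : Cmd

namespace Cmd

/-- Translation into programs of the machine. The register `4` is expected to hold the number `1`,
by which loop counters are incremented. -/
def compile : Cmd → Prog
  | skip => .skip
  | const x v => .const x v
  | add x y z => .add x y z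
  | load x a y => .load x a y
  | store a x y => .store a x y
  | seq p q => .seq p.compile q.compile
  | ifLt x y p q => .ifLt x y p.compile q.compile
  | loop x y p => .seq (.const x 0) (.whileLt x y (.seq p.compile (.add x x 4)))

/-- The effect of a program on the store. -/
def eval : Cmd → Store → Store
  | skip => fun s => s
  | const x v => fun s => s.setReg x v
  | add x y z => fun s => s.setReg x (s.reg y + s.reg z)
  | load x a y => fun s => s.setReg x (s.mem a (s.reg y))
  | store a x y => fun s => s.setMem a (s.reg x) (s.reg y)
  | seq p q => fun s => q.eval (p.eval s)
  | ifLt x y p q => fun s => if s.reg x < s.reg y then p.eval s else q.eval s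
  -- The number of rounds is read once, at entry, whereas the machine tests again each round. The
  -- two agree because `exec_compile` forbids a body to change its counter or any loop bound.
  | loop x y p => fun s =>
      (fun s => (p.eval s).setReg x ((p.eval s).reg x + 1))^[s.reg y] (s.setReg x 0)

/-- The registers that a program may change. -/
def writes : Cmd → List ℕ
  | skip => []
  | const x _ => [x]
  | add x _ _ => [x]
  | load x _ _ => [x]
  | store _ _ _ => []
  | seq p q => p.writes ++ q.writes
  | ifLt _ _ p q => p.writes ++ q.writes
  | loop x _ p => x :: p.writes

/-- The arrays that a program may change. -/
def memWrites : Cmd → List ℕ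
  | skip => []
  | const _ _ => []
  | add _ _ _ => []
  | load _ _ _ => []
  | store a _ _ => [a]
  | seq p q => p.memWrites ++ q.memWrites
  | ifLt _ _ p q => p.memWrites ++ q.memWrites
  | loop _ _ p => p.memWrites

/-- The registers that bound the loops of a program. -/
def bounds : Cmd → List ℕ
  | skip => []
  | const _ _ => []
  | add _ _ _ => []
  | load _ _ _ => []
  | store _ _ _ => []
  | seq p q => p.bounds ++ q.bounds
  | ifLt _ _ p q => p.bounds ++ q.bounds
  | loop _ y p => y :: p.bounds

/-- No loop body changes the loop counter. -/
def countersSafe : Cmd → Bool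
  | skip => true
  | const _ _ => true
  | add _ _ _ => true
  | load _ _ _ => true
  | store _ _ _ => true
  | seq p q => p.countersSafe && q.countersSafe
  | ifLt _ _ p q => p.countersSafe && q.countersSafe
  | loop x _ p => p.countersSafe && decide (x ∉ p.writes)

/-- A bound for the number of steps when all loop bounds are at most `R`. -/
def cost (R : ℕ) : Cmd → ℕ
  | skip => 1
  | const _ _ => 1
  | add _ _ _ => 1
  | load _ _ _ => 1
  | store _ _ _ => 1
  | seq p q => p.cost R + q.cost R
  | ifLt _ _ p q => p.cost R + q.cost R + 1
  -- Each round pays for the body, the increment and the test; the last `2` is the initialisation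
  -- and the failing test.
  | loop _ _ p => R * (p.cost R + 2) + 2

theorem eval_reg_of_notMem {c : Cmd} {s : Store} {r : ℕ} (h : r ∉ c.writes) :
    (c.eval s).reg r = s.reg r := by
  induction c generalizing s with
  | skip => rfl
  | const x v => simp_all [eval, writes]
  | add x y z => simp_all [eval, writes]
  | load x a y => simp_all [eval, writes]
  | store a x y => simp_all [eval, writes]
  | seq p q ihp ihq =>
    simp only [writes, List.mem_append, not_or] at h
    simp only [eval]
    rw [ihq h.2, ihp h.1]
  | ifLt x y p q ihp ihq =>
    simp only [writes, List.mem_append, not_or] at h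
    simp only [eval]
    split_ifs
    exacts [ihp h.1, ihq h.2]
  | loop x y p ih =>
    simp only [writes, List.mem_cons, not_or] at h
    simp only [eval]
    have key : ∀ (m : ℕ) (s : Store),
        ((fun s => (p.eval s).setReg x ((p.eval s).reg x + 1))^[m] s).reg r = s.reg r := by
      intro m
      induction m with
      | zero => simp
      | succ m ihm =>
        intro s
        rw [Function.iterate_succ_apply, ihm]
        simp [h.1, ih h.2]
    rw [key]
    simp [h.1]

theorem eval_mem_of_notMem {c : Cmd} {s : Store} {a : ℕ} (h : a ∉ c.memWrites) :
    (c.eval s).mem a = s.mem a := by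
  induction c generalizing s with
  | skip => rfl
  | const x v => simp_all [eval, memWrites]
  | add x y z => simp_all [eval, memWrites]
  | load x a y => simp_all [eval, memWrites]
  | store a x y => ext; simp_all [eval, memWrites]
  | seq p q ihp ihq =>
    simp only [memWrites, List.mem_append, not_or] at h
    simp only [eval]
    rw [ihq h.2, ihp h.1]
  | ifLt x y p q ihp ihq =>
    simp only [memWrites, List.mem_append, not_or] at h
    simp only [eval]
    split_ifs
    exacts [ihp h.1, ihq h.2]
  | loop x y p ih =>
    simp only [memWrites] at h
    simp only [eval]
    have key : ∀ (m : ℕ) (s : Store),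
        ((fun s => (p.eval s).setReg x ((p.eval s).reg x + 1))^[m] s).mem a = s.mem a := by
      intro m
      induction m with
      | zero => simp
      | succ m ihm =>
        intro s
        rw [Function.iterate_succ_apply, ihm]
        simp [ih h]
    rw [key]
    simp

/-- Invariants of loops. -/
theorem eval_loop_induct {x y : ℕ} {p : Cmd} {s : Store} (I : ℕ → Store → Prop)
    (hx : x ∉ p.writes) (h0 : I 0 (s.setReg x 0))
    (hs : ∀ j < s.reg y, ∀ s' : Store, s'.reg x = j →
      (∀ r ∉ (loop x y p).writes, s'.reg r = s.reg r) → (∀ a ∉ p.memWrites, s'.mem a = s.mem a) →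
      I j s' → I (j + 1) ((p.eval s').setReg x (j + 1))) :
    I (s.reg y) ((loop x y p).eval s) := by
  simp only [eval]
  set F : Store → Store := fun s => (p.eval s).setReg x ((p.eval s).reg x + 1) with hF
  -- The frame conditions are carried along, so that `I` need only mention what the loop changes.
  have key : ∀ j ≤ s.reg y, (F^[j] (s.setReg x 0)).reg x = j ∧
      (∀ r ∉ (loop x y p).writes, (F^[j] (s.setReg x 0)).reg r = s.reg r) ∧
      (∀ a ∉ p.memWrites, (F^[j] (s.setReg x 0)).mem a = s.mem a) ∧
      I j (F^[j] (s.setReg x 0)) := by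
    intro j
    induction j with
    | zero =>
      intro _
      refine ⟨by simp, fun r hr => ?_, by simp, h0⟩
      simp only [writes, List.mem_cons, not_or] at hr
      simp [hr.1]
    | succ j ih =>
      intro hj
      obtain ⟨h1, h2, h3, h4⟩ := ih (by omega)
      have hFx : (p.eval (F^[j] (s.setReg x 0))).reg x = j := by
        rw [eval_reg_of_notMem hx, h1]
      have hFs : F^[j + 1] (s.setReg x 0) =
          (p.eval (F^[j] (s.setReg x 0))).setReg x (j + 1) := by
        rw [Function.iterate_succ_apply', hF]
        simp only
        rw [← hF, hFx]
      rw [hFs]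
      refine ⟨by simp, fun r hr => ?_, fun a ha => ?_, hs j (by omega) _ h1 h2 h3 h4⟩
      · have hr' := hr
        simp only [writes, List.mem_cons, not_or] at hr'
        simp only [Store.reg_setReg, hr'.1, if_false]
        rw [eval_reg_of_notMem hr'.2, h2 r hr]
      · rw [Store.mem_setReg, eval_mem_of_notMem ha, h3 a ha]
  exact (key _ le_rfl).2.2.2

/-- A compiled program computes its effect, within the bound for its number of steps. -/
theorem exec_compile {R : ℕ} {c : Cmd} {s : Store} (hc : c.countersSafe = true)
    (h4 : 4 ∉ c.writes) (hone : s.reg 4 = 1) (hb : ∀ y ∈ c.bounds, y ∉ c.writes)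
    (hR : ∀ y ∈ c.bounds, s.reg y ≤ R) :
    ∃ t ≤ c.cost R, Exec c.compile s t (c.eval s) := by
  induction c generalizing s with
  | skip => exact ⟨1, le_rfl, .skip s⟩
  | const x v => exact ⟨1, le_rfl, .const s x v⟩
  | add x y z => exact ⟨1, le_rfl, .add s x y z⟩
  | load x a y => exact ⟨1, le_rfl, .load s x a y⟩
  | store a x y => exact ⟨1, le_rfl, .store s a x y⟩
  | seq p q ihp ihq =>
    simp only [countersSafe, Bool.and_eq_true] at hc
    simp only [writes, bounds, List.mem_append, not_or] at h4 hb hR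
    obtain ⟨t₁, ht₁, e₁⟩ := ihp hc.1 h4.1 hone (fun y hy => (hb y (.inl hy)).1)
      (fun y hy => hR y (.inl hy))
    obtain ⟨t₂, ht₂, e₂⟩ := ihq (s := p.eval s) hc.2 h4.2
      (by rw [eval_reg_of_notMem h4.1, hone]) (fun y hy => (hb y (.inr hy)).2)
      (fun y hy => by rw [eval_reg_of_notMem (hb y (.inr hy)).1]; exact hR y (.inr hy))
    exact ⟨t₁ + t₂, by simp only [cost]; omega, .seq e₁ e₂⟩
  | ifLt x y p q ihp ihq =>
    simp only [countersSafe, Bool.and_eq_true] at hc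
    simp only [writes, bounds, List.mem_append, not_or] at h4 hb hR
    simp only [eval, compile, cost]
    split_ifs with h
    · obtain ⟨t₁, ht₁, e₁⟩ := ihp hc.1 h4.1 hone (fun y hy => (hb y (.inl hy)).1)
        (fun y hy => hR y (.inl hy))
      exact ⟨t₁ + 1, by omega, .ifTrue h e₁⟩
    · obtain ⟨t₂, ht₂, e₂⟩ := ihq hc.2 h4.2 hone (fun y hy => (hb y (.inr hy)).2)
        (fun y hy => hR y (.inr hy))
      exact ⟨t₂ + 1, by omega, .ifFalse h e₂⟩
  | loop x y p ih =>
    simp only [countersSafe, Bool.and_eq_true, decide_eq_true_eq] at hc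
    simp only [writes, bounds, List.mem_cons, not_or, forall_eq_or_imp] at h4 hb hR
    set F : Store → Store := fun s => (p.eval s).setReg x ((p.eval s).reg x + 1) with hF
    have step : ∀ s : Store, s.reg 4 = 1 → (∀ z ∈ p.bounds, s.reg z ≤ R) →
        ∃ t ≤ p.cost R + 1, Exec (.seq p.compile (.add x x 4)) s t (F s) := by
      intro s hs1 hs2
      obtain ⟨t, ht, e⟩ := ih hc.1 h4.2 hs1 (fun z hz => (hb.2 z hz).2) hs2
      refine ⟨t + 1, by omega, .seq e ?_⟩
      have := Exec.add (p.eval s) x x 4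
      rwa [eval_reg_of_notMem h4.2, hs1] at this
    -- Induction on the number `d` of remaining rounds.
    have main : ∀ (d : ℕ) (s : Store), s.reg 4 = 1 → (∀ z ∈ p.bounds, s.reg z ≤ R) →
        s.reg x + d = s.reg y →
        ∃ t ≤ d * (p.cost R + 2) + 1,
          Exec (.whileLt x y (.seq p.compile (.add x x 4))) s t (F^[d] s) := by
      intro d
      induction d with
      | zero =>
        intro s _ _ hd
        exact ⟨1, by omega, .whileFalse (by omega)⟩
      | succ d ihd =>
        intro s hs1 hs2 hd
        obtain ⟨t₁, ht₁, e₁⟩ := step s hs1 hs2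
        have hF4 : (F s).reg 4 = 1 := by simp [hF, h4.1, eval_reg_of_notMem h4.2, hs1]
        have hFy : (F s).reg y = s.reg y := by
          simp [hF, hb.1.1, eval_reg_of_notMem hb.1.2]
        have hFx : (F s).reg x = s.reg x + 1 := by
          simp [hF, eval_reg_of_notMem hc.2]
        have hFz : ∀ z ∈ p.bounds, (F s).reg z ≤ R := fun z hz => by
          simpa [hF, (hb.2 z hz).1, eval_reg_of_notMem (hb.2 z hz).2] using hs2 z hz
        obtain ⟨t₂, ht₂, e₂⟩ := ihd (F s) hF4 hFz (by omega)
        refine ⟨t₁ + t₂ + 1, ?_, ?_⟩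
        · have : (d + 1) * (p.cost R + 2) = d * (p.cost R + 2) + (p.cost R + 2) := by ring
          omega
        · rw [Function.iterate_succ_apply]
          exact .whileTrue (by omega) e₁ e₂
    obtain ⟨t, ht, e⟩ := main (s.reg y) (s.setReg x 0) (by simp [h4.1, hone])
      (fun z hz => by simpa [(hb.2 z hz).1] using hR.2 z hz) (by simp [hb.1.1])
    refine ⟨1 + t, ?_, .seq (.const s x 0) e⟩
    have : s.reg y * (p.cost R + 2) ≤ R * (p.cost R + 2) := Nat.mul_le_mul_right _ hR.1
    simp only [cost]
    omega

/-- The bound for the number of steps is polynomial in the bound for the loops. -/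
theorem exists_cost_le (c : Cmd) : ∃ D e : ℕ, ∀ R, c.cost R ≤ D * (R + 1) ^ e := by
  have one : ∃ D e : ℕ, ∀ R : ℕ, 1 ≤ D * (R + 1) ^ e := ⟨1, 0, by simp⟩
  have join : ∀ {f g : ℕ → ℕ}, (∃ D e : ℕ, ∀ R, f R ≤ D * (R + 1) ^ e) →
      (∃ D e : ℕ, ∀ R, g R ≤ D * (R + 1) ^ e) →
      ∃ D e : ℕ, ∀ R, f R + g R + 1 ≤ D * (R + 1) ^ e := by
    rintro f g ⟨D₁, e₁, h₁⟩ ⟨D₂, e₂, h₂⟩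
    refine ⟨D₁ + D₂ + 1, e₁ + e₂, fun R => ?_⟩
    have i₁ : (R + 1) ^ e₁ ≤ (R + 1) ^ (e₁ + e₂) := Nat.pow_le_pow_right (by omega) (by omega)
    have i₂ : (R + 1) ^ e₂ ≤ (R + 1) ^ (e₁ + e₂) := Nat.pow_le_pow_right (by omega) (by omega)
    have i₃ : 1 ≤ (R + 1) ^ (e₁ + e₂) := Nat.one_le_pow _ _ (by omega)
    calc f R + g R + 1 ≤ D₁ * (R + 1) ^ e₁ + D₂ * (R + 1) ^ e₂ + 1 := by
          have := h₁ R; have := h₂ R; omega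
      _ ≤ D₁ * (R + 1) ^ (e₁ + e₂) + D₂ * (R + 1) ^ (e₁ + e₂) + (R + 1) ^ (e₁ + e₂) := by gcongr
      _ = _ := by ring
  induction c with
  | skip => exact one
  | const x v => exact one
  | add x y z => exact one
  | load x a y => exact one
  | store a x y => exact one
  | seq p q ihp ihq =>
    obtain ⟨D, e, h⟩ := join ihp ihq
    exact ⟨D, e, fun R => (by simp only [cost]; omega : _ ≤ _).trans (h R)⟩
  | ifLt x y p q ihp ihq => exact join ihp ihq
  | loop x y p ih =>
    obtain ⟨D, e, h⟩ := ih
    refine ⟨D + 4, e + 1, fun R => ?_⟩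
    have i₃ : 1 ≤ (R + 1) ^ e := Nat.one_le_pow _ _ (by omega)
    calc R * (p.cost R + 2) + 2 ≤ (R + 1) * (D * (R + 1) ^ e + 2) + 2 * (R + 1) := by
          have := h R
          have : R * (p.cost R + 2) ≤ (R + 1) * (D * (R + 1) ^ e + 2) :=
            Nat.mul_le_mul (by omega) (by omega)
          omega
      _ = (R + 1) * (D * (R + 1) ^ e + 4 * 1) := by ring
      _ ≤ (R + 1) * (D * (R + 1) ^ e + 4 * (R + 1) ^ e) := by gcongr
      _ = _ := by ring

end Cmd

/-! ### The greedy construction of the measurement matrix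

Registers: `0` number of columns `n` at the start, number of rows at the end; `1` sparsity `k`;
`2`, `3` numerator and denominator of the error probability; `4` the number one; `5` number `2 * n`
of candidate columns; `6` size of the alphabet; `7` length of the code; `8` number of rows;
`9` the number zero; `10` copy of `n`; `15`, `16`, `17` the counters `j` (column), `l` (position)
and `i`; the others are auxiliary. Arrays: `0` the matrix; `1` for columns `i < j` the number
`2 ^ (number of agreements) - 1`; `2` the code; `3` cost of the symbols; `4` selected columns;
`5` row sums of the array `1`, symmetrised. -/

namespace Cmd

/-- `r[z] := r[x] * r[y] + r[w]` -/
def mulAdd (z x y w : ℕ) : Cmd := .seq (.add z w 9) (.loop 14 y (.add z z x))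

def clearCosts : Cmd := .loop 17 6 (.store 3 17 9)

/-- Registers `18` and `19` hold the offsets `j * (2 * n)` and `l * (2 * n)`. Each earlier column
adds its weight `2 ^ (agreements)` to the cost of its symbol. The loop runs to register `5` under
the guard `i < j`, since register `15` is itself a loop counter and may not serve as a loop bound.
-/
def tallyCosts : Cmd :=
  .loop 17 5 (.ifLt 17 15
    (.seq (.add 20 19 17) (.seq (.load 22 2 20) (.seq (.add 20 18 17) (.seq (.load 21 1 20)
      (.seq (.add 21 21 4) (.seq (.load 23 3 22) (.seq (.add 23 23 21) (.store 3 22 23))))))))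
    .skip)

def cheapestLoop : Cmd :=
  .loop 17 6 (.seq (.load 21 3 17) (.seq (.load 23 3 24) (.ifLt 21 23 (.add 24 17 9) .skip)))

/-- Replacing `y` by `2 * y + 1` doubles the weight `y + 1`; storing the weight minus one makes the
initial zeros correct. Equality of symbols is tested by two comparisons. -/
def updateLoop : Cmd :=
  .loop 17 5 (.ifLt 17 15
    (.seq (.add 20 19 17) (.seq (.load 22 2 20) (.ifLt 22 24 .skip (.ifLt 24 22 .skip
      (.seq (.add 20 18 17) (.seq (.load 21 1 20) (.seq (.add 21 21 21) (.seq (.add 21 21 4)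
        (.store 1 20 21))))))))) .skip)

/-- Choose the symbol of the column `r[15]` at the position `r[16]`. -/
def chooseSymbol : Cmd :=
  .seq (mulAdd 19 16 5 9) (.seq clearCosts (.seq tallyCosts (.seq (.const 24 0) (.seq cheapestLoop
    (.seq (.add 20 19 15) (.seq (.store 2 20 24) updateLoop))))))

def symbolLoop : Cmd := .loop 16 7 chooseSymbol

def columnLoop : Cmd := .loop 15 5 (.seq (mulAdd 18 15 5 9) symbolLoop)

/-! ### Correctness of one greedy choice. -/

theorem reg_mulAdd {z x y w : ℕ} {s : Store} (h9 : s.reg 9 = 0) (hz : z ≠ 14) (hx : x ≠ 14)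
    (hzx : z ≠ x) (hzy : z ≠ y) :
    ((mulAdd z x y w).eval s).reg z = s.reg x * s.reg y + s.reg w := by
  have h := eval_loop_induct (x := 14) (y := y) (p := .add z z x) (s := s.setReg z (s.reg w))
    (fun j s' => s'.reg z = s.reg x * j + s.reg w) (by simp [writes, hz.symm]) (by simp [hz])
    (by
      intro j _ s' _ hr _ hI
      have hx' : s'.reg x = s.reg x := by
        rw [hr x (by simp [writes, hx, hzx.symm])]
        simp [hzx.symm]
      simp only [eval, Store.reg_setReg, hz, if_false, if_true, hI, hx']
      ring)
  simp only [mulAdd]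
  have e : (seq (.add z w 9) (.loop 14 y (.add z z x))).eval s =
      (loop 14 y (.add z z x)).eval (s.setReg z (s.reg w)) := by
    simp only [eval, h9, add_zero]
  rw [e, h]
  simp [hzy.symm]

theorem mem_mulAdd {z x y w : ℕ} {s : Store} : ((mulAdd z x y w).eval s).mem = s.mem := by
  ext1 a
  exact eval_mem_of_notMem (by simp [mulAdd, memWrites])

theorem reg_mulAdd_of_ne {z x y w r : ℕ} {s : Store} (hz : r ≠ z) (h14 : r ≠ 14) :
    ((mulAdd z x y w).eval s).reg r = s.reg r :=
  eval_reg_of_notMem (by simp [mulAdd, writes, hz, h14])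

theorem mem_clearCosts {s : Store} (h9 : s.reg 9 = 0) :
    ∀ z < s.reg 6, (clearCosts.eval s).mem 3 z = 0 := by
  refine eval_loop_induct (fun j s' => ∀ z < j, s'.mem 3 z = 0) (by decide) (by simp) ?_
  intro j _ s' hj hr _ hI z hz
  have h9' : s'.reg 9 = 0 := by rw [hr 9 (by decide), h9]
  simp only [eval, Store.mem_setReg, Store.mem_setMem, if_true, hj, h9']
  split_ifs with h
  · rfl
  · exact hI z (by omega)

theorem mem_tallyCosts {s : Store} (h4 : s.reg 4 = 1) (z : ℕ) :
    (tallyCosts.eval s).mem 3 z = s.mem 3 z + ∑ i ∈ Finset.range (s.reg 5),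
      if i < s.reg 15 ∧ s.mem 2 (s.reg 19 + i) = z then s.mem 1 (s.reg 18 + i) + 1 else 0 := by
  refine eval_loop_induct (fun j s' => s'.mem 3 z = s.mem 3 z + ∑ i ∈ Finset.range j,
      if i < s.reg 15 ∧ s.mem 2 (s.reg 19 + i) = z then s.mem 1 (s.reg 18 + i) + 1 else 0)
    (by decide) (by simp) ?_
  intro j _ s' hj hr hm hI
  have h4' := hr 4 (by decide)
  have h15 := hr 15 (by decide)
  have h18 := hr 18 (by decide)
  have h19 := hr 19 (by decide)
  have m1 := hm 1 (by decide)
  have m2 := hm 2 (by decide)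
  rw [Finset.sum_range_succ, ← add_assoc, ← hI]
  simp only [eval, hj, h15]
  by_cases hlt : j < s.reg 15
  · simp [hlt, hj, h18, h19, m1, m2, h4', h4]
    split_ifs with h1 h2 h2
    · rw [h1]
    · exact absurd h1.symm h2
    · exact absurd h2.symm h1
    · rfl
  · simp [hlt]

theorem reg_cheapestLoop {s : Store} (h9 : s.reg 9 = 0) (h24 : s.reg 24 = 0) (hq : 0 < s.reg 6) :
    (cheapestLoop.eval s).reg 24 < s.reg 6 ∧
      ∀ z < s.reg 6, s.mem 3 ((cheapestLoop.eval s).reg 24) ≤ s.mem 3 z := by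
  refine eval_loop_induct (fun j s' => s'.reg 24 < s.reg 6 ∧
    ∀ z < j, s.mem 3 (s'.reg 24) ≤ s.mem 3 z) (by decide) (by simp [h24, hq]) ?_
  intro j hjq s' hj hr hm hI
  have h9' := hr 9 (by decide)
  have m3 := hm 3 (by decide)
  simp only [eval]
  simp [hj, m3]
  split_ifs with h
  · simp only [Store.reg_setReg]
    simp [h9', h9, hjq]
    intro z hz
    rcases Nat.le_iff_lt_or_eq.1 hz with h' | rfl
    · exact h.le.trans (hI.2 z h')
    · rfl
  · simp
    refine ⟨hI.1, fun z hz => ?_⟩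
    rcases Nat.le_iff_lt_or_eq.1 hz with h' | rfl
    · exact hI.2 z h'
    · exact not_lt.1 h

theorem mem_updateLoop {s : Store} (h4 : s.reg 4 = 1) (p : ℕ) :
    (updateLoop.eval s).mem 1 p =
      if s.reg 18 ≤ p ∧ p < s.reg 18 + s.reg 5 ∧ p < s.reg 18 + s.reg 15 ∧
        s.mem 2 (s.reg 19 + (p - s.reg 18)) = s.reg 24
      then 2 * s.mem 1 p + 1 else s.mem 1 p := by
  refine eval_loop_induct (fun j s' => s'.mem 1 p =
      if s.reg 18 ≤ p ∧ p < s.reg 18 + j ∧ p < s.reg 18 + s.reg 15 ∧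
        s.mem 2 (s.reg 19 + (p - s.reg 18)) = s.reg 24
      then 2 * s.mem 1 p + 1 else s.mem 1 p) (by decide) ?_ ?_
  · rw [if_neg (by omega)]
    simp
  intro j _ s' hj hr hm hI
  have h4' := hr 4 (by decide)
  have h15 := hr 15 (by decide)
  have h18 := hr 18 (by decide)
  have h19 := hr 19 (by decide)
  have h24 := hr 24 (by decide)
  have m2 := hm 2 (by decide)
  by_cases hp : p = s.reg 18 + j
  -- The address `p` is touched only in this round, so it still holds its initial value.
  · have hI' : s'.mem 1 p = s.mem 1 p := by rw [hI, if_neg (by omega)]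
    subst hp
    simp only [Store.mem_setReg, add_tsub_cancel_left]
    simp only [eval]
    simp only [Store.reg_setReg, Store.mem_setReg, hj, h15, h18, h19, h24, m2, h4', h4]
    by_cases hlt : j < s.reg 15
    · by_cases he : s.mem 2 (s.reg 19 + j) = s.reg 24
      · simp [hlt, he, hI']
        ring
      · rcases lt_or_gt_of_ne he with he' | he'
        · simp [hlt, he, hI', he']
        · simp [hlt, he, hI', he', not_lt.2 he'.le]
    · simp [hlt, hI']
  · have hsame : ((eval (.ifLt 17 15
      (.seq (.add 20 19 17) (.seq (.load 22 2 20) (.ifLt 22 24 .skip (.ifLt 24 22 .skip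
      (.seq (.add 20 18 17) (.seq (.load 21 1 20) (.seq (.add 21 21 21) (.seq (.add 21 21 4)
        (.store 1 20 21))))))))) .skip) s').setReg 17 (j + 1)).mem 1 p = s'.mem 1 p := by
      simp only [Store.mem_setReg]
      simp only [eval]
      split_ifs <;> simp [h18, hj] <;> split_ifs <;> simp [hp]
    rw [hsame, hI]
    congr 1
    apply propext
    constructor <;> rintro ⟨h1, h2, h3⟩ <;> exact ⟨h1, by omega, h3⟩

/-- Conditional expectations: some symbol costs at most the average. -/
theorem mul_sum_filter_le {ι : Type*} {J : Finset ι} {g w : ι → ℕ} {q b : ℕ}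
    (hg : ∀ i ∈ J, g i < q) (hb : ∀ z < q, (∑ i ∈ J with g i = b, w i) ≤ ∑ i ∈ J with g i = z, w i) :
    q * (∑ i ∈ J with g i = b, w i) ≤ ∑ i ∈ J, w i := by
  rw [← Finset.sum_fiberwise_of_maps_to (t := Finset.range q) (g := g)
    (fun i hi => Finset.mem_range.2 (hg i hi))]
  calc q * (∑ i ∈ J with g i = b, w i)
      = ∑ _z ∈ Finset.range q, ∑ i ∈ J with g i = b, w i := by simp
    _ ≤ _ := Finset.sum_le_sum fun z hz => hb z (Finset.mem_range.1 hz)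

/-- The last conjunct is the derandomisation: the cheapest of `q` symbols carries at most the
fraction `1 / q` of the total weight, as a random symbol would on average. -/
theorem chooseSymbol_spec {s : Store} {nn q j l : ℕ} (h4 : s.reg 4 = 1) (h9 : s.reg 9 = 0)
    (h5 : s.reg 5 = nn) (h6 : s.reg 6 = q) (h15 : s.reg 15 = j) (h16 : s.reg 16 = l)
    (h18 : s.reg 18 = j * nn) (hq : 0 < q) (hj : j < nn)
    (hc : ∀ i < j, s.mem 2 (l * nn + i) < q) :
    ∃ b < q, (∀ p, (chooseSymbol.eval s).mem 2 p = if p = l * nn + j then b else s.mem 2 p) ∧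
      (∀ i < nn, (chooseSymbol.eval s).mem 1 (j * nn + i) =
        if i < j ∧ s.mem 2 (l * nn + i) = b then 2 * s.mem 1 (j * nn + i) + 1
        else s.mem 1 (j * nn + i)) ∧
      (∀ j' i, j' ≠ j → i < nn →
        (chooseSymbol.eval s).mem 1 (j' * nn + i) = s.mem 1 (j' * nn + i)) ∧
      q * (∑ i ∈ Finset.range j with s.mem 2 (l * nn + i) = b, (s.mem 1 (j * nn + i) + 1)) ≤
        ∑ i ∈ Finset.range j, (s.mem 1 (j * nn + i) + 1) := by
  set s₁ := (mulAdd 19 16 5 9).eval s with hs₁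
  have r₁ : ∀ r, r ≠ 19 → r ≠ 14 → s₁.reg r = s.reg r := fun r hr hr' =>
    reg_mulAdd_of_ne hr hr'
  have h19₁ : s₁.reg 19 = l * nn := by
    rw [hs₁, reg_mulAdd h9 (by decide) (by decide) (by decide) (by decide), h16, h5, h9, add_zero]
  have m₁ : s₁.mem = s.mem := mem_mulAdd
  set s₂ := clearCosts.eval s₁ with hs₂
  have r₂ : ∀ r, r ≠ 17 → s₂.reg r = s₁.reg r := fun r hr =>
    eval_reg_of_notMem (by simp [clearCosts, writes, hr])
  have m₂ : ∀ a, a ≠ 3 → s₂.mem a = s₁.mem a := fun a ha =>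
    eval_mem_of_notMem (by simp [clearCosts, memWrites, ha])
  have c₂ : ∀ z < q, s₂.mem 3 z = 0 := by
    have := mem_clearCosts (s := s₁) (by rw [r₁ 9 (by decide) (by decide), h9])
    rwa [r₁ 6 (by decide) (by decide), h6] at this
  set s₃ := tallyCosts.eval s₂ with hs₃
  have r₃ : ∀ r, r ∉ tallyCosts.writes → s₃.reg r = s₂.reg r := fun r hr => eval_reg_of_notMem hr
  have m₃ : ∀ a, a ≠ 3 → s₃.mem a = s₂.mem a := fun a ha =>
    eval_mem_of_notMem (by simp [tallyCosts, memWrites, ha])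
  have c₃ : ∀ z < q, s₃.mem 3 z =
      ∑ i ∈ Finset.range j with s.mem 2 (l * nn + i) = z, (s.mem 1 (j * nn + i) + 1) := by
    intro z hz
    have := mem_tallyCosts (s := s₂) (by simp [r₂, r₁, h4]) z
    rw [hs₃, this, c₂ z hz, zero_add, m₂ 1 (by decide), m₂ 2 (by decide), m₁]
    simp only [r₂, r₁, ne_eq, not_false_eq_true, Nat.reduceEqDiff, h5, h15,
      h18, h19₁]
    rw [← Finset.sum_filter]
    refine Finset.sum_congr ?_ fun _ _ => rfl
    ext i
    simp only [Finset.mem_filter, Finset.mem_range]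
    constructor
    · rintro ⟨_, h⟩; exact h
    · rintro h; exact ⟨by omega, h⟩
  set s₄ := cheapestLoop.eval (s₃.setReg 24 0) with hs₄
  have hcheap := reg_cheapestLoop (s := s₃.setReg 24 0)
    (by simp [r₃ 9 (by decide), r₂, r₁, h9]) (by simp)
    (by simp [r₃ 6 (by decide), r₂, r₁, h6, hq])
  rw [← hs₄] at hcheap
  have e6 : (s₃.setReg 24 0).reg 6 = q := by simp [r₃ 6 (by decide), r₂, r₁, h6]
  rw [e6] at hcheap
  have r₄ : ∀ r, r ∉ cheapestLoop.writes → r ≠ 24 → s₄.reg r = s₃.reg r := fun r hr hr' => by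
    rw [hs₄, eval_reg_of_notMem hr]; simp [hr']
  have m₄ : s₄.mem = s₃.mem := by
    ext1 a
    rw [hs₄, eval_mem_of_notMem (by simp [cheapestLoop, memWrites]), Store.mem_setReg]
  obtain ⟨hb, hmin⟩ := hcheap
  set b := s₄.reg 24 with hbdef
  have g4 : s₄.reg 4 = 1 := by simp [r₄ 4 (by decide), r₃ 4 (by decide), r₂, r₁, h4]
  have g5 : s₄.reg 5 = nn := by simp [r₄ 5 (by decide), r₃ 5 (by decide), r₂, r₁, h5]
  have g15 : s₄.reg 15 = j := by simp [r₄ 15 (by decide), r₃ 15 (by decide), r₂, r₁, h15]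
  have g18 : s₄.reg 18 = j * nn := by simp [r₄ 18 (by decide), r₃ 18 (by decide), r₂, r₁, h18]
  have g19 : s₄.reg 19 = l * nn := by simp [r₄ 19 (by decide), r₃ 19 (by decide), r₂, h19₁]
  have k1 : s₄.mem 1 = s.mem 1 := by rw [m₄, m₃ 1 (by decide), m₂ 1 (by decide), m₁]
  have k2 : s₄.mem 2 = s.mem 2 := by rw [m₄, m₃ 2 (by decide), m₂ 2 (by decide), m₁]
  set s₅ := (s₄.setReg 20 (l * nn + j)).setMem 2 (l * nn + j) b with hs₅
  have hfin : chooseSymbol.eval s = updateLoop.eval s₅ := by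
    rw [hs₅, hbdef, ← g19, ← g15, hs₄, hs₃, hs₂, hs₁]
    simp [chooseSymbol, eval]
  have hupd : ∀ p, (chooseSymbol.eval s).mem 1 p =
      if j * nn ≤ p ∧ p < j * nn + nn ∧ p < j * nn + j ∧ s.mem 2 (l * nn + (p - j * nn)) = b
      then 2 * s.mem 1 p + 1 else s.mem 1 p := by
    intro p
    rw [hfin, mem_updateLoop (by simp [hs₅, g4])]
    simp only [hs₅, Store.reg_setMem, Store.reg_setReg, Store.mem_setMem, Store.mem_setReg,
      Nat.reduceEqDiff, if_false, if_true, g18, g5, g15,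
      g19, k1, k2, ← hbdef]
    congr 1
    apply propext
    refine and_congr_right fun a1 => and_congr_right fun a2 => and_congr_right fun a3 => ?_
    rw [if_neg (by omega)]
  refine ⟨b, hb, fun p => ?_, fun i hi => ?_, fun j' i hj' hi => ?_, ?_⟩
  · rw [hfin, eval_mem_of_notMem (by decide)]
    simp [hs₅, k2]
  · rw [hupd, add_tsub_cancel_left]
    congr 1
    apply propext
    constructor
    · rintro ⟨_, _, h1, h2⟩; exact ⟨by omega, h2⟩
    · rintro ⟨h1, h2⟩; exact ⟨by omega, by omega, by omega, h2⟩
  · rw [hupd, if_neg]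
    rintro ⟨h1, h2, -⟩
    rcases lt_or_gt_of_ne hj' with h | h
    · have := Nat.mul_le_mul_right nn (show j' + 1 ≤ j from h)
      rw [Nat.add_mul] at this
      omega
    · have := Nat.mul_le_mul_right nn (show j + 1 ≤ j' from h)
      rw [Nat.add_mul] at this
      omega
  · refine mul_sum_filter_le (fun i hi => hc i (Finset.mem_range.1 hi)) fun z hz => ?_
    have := hmin z hz
    simp only [Store.mem_setReg] at this
    rwa [c₃ z hz, c₃ b hb] at this

/-! ### Agreement of columns and the weight invariant of the greedy code. -/

theorem mul_add_inj_iff {n a b i j : ℕ} (hi : i < n) (hj : j < n) :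
    a * n + i = b * n + j ↔ a = b ∧ i = j := by
  constructor
  · intro h
    have hab : a = b := by
      have := congrArg (· / n) h
      simpa [Nat.add_div_of_dvd_right, Nat.mul_div_cancel _ (by omega : 0 < n),
        Nat.div_eq_of_lt hi, Nat.div_eq_of_lt hj] using this
    subst hab
    exact ⟨rfl, by omega⟩
  · rintro ⟨rfl, rfl⟩; rfl

/-- Number of positions below `L` at which the columns `i` and `j` of the code agree. -/
def agree (c : ℕ → ℕ) (nn L i j : ℕ) : ℕ :=
  ((Finset.range L).filter fun l => c (l * nn + i) = c (l * nn + j)).card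

theorem agree_succ (c : ℕ → ℕ) (nn L i j : ℕ) : agree c nn (L + 1) i j =
    agree c nn L i j + if c (L * nn + i) = c (L * nn + j) then 1 else 0 := by
  unfold agree
  rw [Finset.range_add_one, Finset.filter_insert]
  split_ifs with h
  · rw [Finset.card_insert_of_notMem (by simp)]
  · rfl

theorem agree_congr {c c' : ℕ → ℕ} {nn L i j : ℕ} (hi : ∀ l < L, c (l * nn + i) = c' (l * nn + i))
    (hj : ∀ l < L, c (l * nn + j) = c' (l * nn + j)) : agree c nn L i j = agree c' nn L i j := by
  unfold agree
  congr 1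
  refine Finset.filter_congr fun l hl => ?_
  rw [hi l (Finset.mem_range.1 hl), hj l (Finset.mem_range.1 hl)]

/-- The first `L` symbols of the column `j` are chosen. -/
structure ColumnInv (y c : ℕ → ℕ) (nn q j L : ℕ) : Prop where
  lt : ∀ l < L, c (l * nn + j) < q
  pow : ∀ i < j, y (j * nn + i) + 1 = 2 ^ agree c nn L i j
  -- The array is strictly lower triangular, so each pair of columns is recorded once.
  zero : ∀ i < nn, j ≤ i → y (j * nn + i) = 0
  -- The expected total for random symbols is `j * (1 + 1 / q) ^ L`; denominators are cleared to
  -- stay in `ℕ`.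
  sum : q ^ L * ∑ i ∈ Finset.range j, (y (j * nn + i) + 1) ≤ j * (q + 1) ^ L

theorem symbolLoop_spec {s : Store} {nn q N j : ℕ} (h4 : s.reg 4 = 1) (h9 : s.reg 9 = 0)
    (h5 : s.reg 5 = nn) (h6 : s.reg 6 = q) (h7 : s.reg 7 = N) (h15 : s.reg 15 = j)
    (h18 : s.reg 18 = j * nn) (hq : 0 < q) (hj : j < nn)
    (hc : ∀ l < N, ∀ i < j, s.mem 2 (l * nn + i) < q) (h0 : ∀ i < nn, s.mem 1 (j * nn + i) = 0) :
    ColumnInv ((symbolLoop.eval s).mem 1) ((symbolLoop.eval s).mem 2) nn q j N ∧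
      (∀ j' i, j' ≠ j → i < nn →
        (symbolLoop.eval s).mem 1 (j' * nn + i) = s.mem 1 (j' * nn + i)) ∧
      (∀ l i, i ≠ j → i < nn →
        (symbolLoop.eval s).mem 2 (l * nn + i) = s.mem 2 (l * nn + i)) := by
  subst h7
  refine eval_loop_induct (fun L s' => ColumnInv (s'.mem 1) (s'.mem 2) nn q j L ∧
      (∀ j' i, j' ≠ j → i < nn → s'.mem 1 (j' * nn + i) = s.mem 1 (j' * nn + i)) ∧
      (∀ l i, i ≠ j → i < nn → s'.mem 2 (l * nn + i) = s.mem 2 (l * nn + i))) (by decide) ?_ ?_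
  · refine ⟨⟨by simp, fun i hi => ?_, fun i hi _ => h0 i hi, ?_⟩, by simp, by simp⟩
    · rw [Store.mem_setReg, h0 i (by omega), show agree _ nn 0 i j = 0 from rfl, pow_zero, zero_add]
    · rw [Finset.sum_congr rfl fun i hi => by
        rw [Store.mem_setReg, h0 i (by have := Finset.mem_range.1 hi; omega)]]
      simp
  intro L hL s' hl hr hm ⟨inv, hy, hcode⟩
  obtain ⟨b, hb, e1, e2, e3, e4⟩ := chooseSymbol_spec (s := s') (nn := nn) (q := q) (j := j) (l := L)
    (by rw [hr 4 (by decide), h4]) (by rw [hr 9 (by decide), h9]) (by rw [hr 5 (by decide), h5])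
    (by rw [hr 6 (by decide), h6]) (by rw [hr 15 (by decide), h15]) hl
    (by rw [hr 18 (by decide), h18]) hq hj
    (fun i hi => by rw [hcode L i (by omega) (by omega)]; exact hc L hL i hi)
  simp only [Store.mem_setReg]
  set c' := (chooseSymbol.eval s').mem 2
  set y' := (chooseSymbol.eval s').mem 1
  have hcne : ∀ l i, i ≠ j → i < nn → c' (l * nn + i) = s'.mem 2 (l * nn + i) := by
    intro l i hij hi
    rw [e1, if_neg]
    rw [mul_add_inj_iff hi hj]
    exact fun h => hij h.2
  have hcold : ∀ l < L, c' (l * nn + j) = s'.mem 2 (l * nn + j) := by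
    intro l hlL
    rw [e1, if_neg]
    rw [mul_add_inj_iff hj hj]
    omega
  have hcnew : c' (L * nn + j) = b := by rw [e1, if_pos rfl]
  have hag : ∀ i < j, agree c' nn L i j = agree (s'.mem 2) nn L i j := fun i hi =>
    agree_congr (fun l _ => hcne l i (by omega) (by omega)) hcold
  refine ⟨⟨fun l hlL => ?_, fun i hi => ?_, fun i hi hji => ?_, ?_⟩, fun j' i hj' hi => ?_,
    fun l i hij hi => ?_⟩
  · rcases Nat.lt_succ_iff_lt_or_eq.1 hlL with h | rfl
    · rw [hcold l h]; exact inv.lt l h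
    · rw [hcnew]; exact hb
  · rw [agree_succ, hag i hi, pow_add, ← inv.pow i hi, e2 i (by omega), hcnew,
      hcne L i (by omega) (by omega)]
    by_cases h : s'.mem 2 (L * nn + i) = b
    · simp only [h, hi, and_self, if_true]; ring
    · simp [h]
  · rw [e2 i hi, if_neg (by omega)]; exact inv.zero i hi hji
  · have hstep : ∑ i ∈ Finset.range j, (y' (j * nn + i) + 1) =
        ∑ i ∈ Finset.range j, (s'.mem 1 (j * nn + i) + 1) +
        ∑ i ∈ Finset.range j with s'.mem 2 (L * nn + i) = b, (s'.mem 1 (j * nn + i) + 1) := by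
      rw [Finset.sum_filter, ← Finset.sum_add_distrib]
      refine Finset.sum_congr rfl fun i hi => ?_
      have hi' := Finset.mem_range.1 hi
      rw [e2 i (by omega)]
      by_cases h : s'.mem 2 (L * nn + i) = b
      · simp only [h, hi', and_self, if_true]; ring
      · simp [h]
    rw [hstep]
    calc q ^ (L + 1) * (∑ i ∈ Finset.range j, (s'.mem 1 (j * nn + i) + 1) +
          ∑ i ∈ Finset.range j with s'.mem 2 (L * nn + i) = b, (s'.mem 1 (j * nn + i) + 1))
        = q ^ L * (q * ∑ i ∈ Finset.range j, (s'.mem 1 (j * nn + i) + 1) +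
          q * ∑ i ∈ Finset.range j with s'.mem 2 (L * nn + i) = b, (s'.mem 1 (j * nn + i) + 1)) := by
          ring
      _ ≤ q ^ L * (q * ∑ i ∈ Finset.range j, (s'.mem 1 (j * nn + i) + 1) +
          ∑ i ∈ Finset.range j, (s'.mem 1 (j * nn + i) + 1)) := by gcongr
      _ = (q + 1) * (q ^ L * ∑ i ∈ Finset.range j, (s'.mem 1 (j * nn + i) + 1)) := by ring
      _ ≤ (q + 1) * (j * (q + 1) ^ L) := Nat.mul_le_mul_left _ inv.sum
      _ = _ := by ring
  · rw [e3 j' i hj' hi, hy j' i hj' hi]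
  · rw [hcne l i hij hi, hcode l i hij hi]

theorem columnLoop_spec {s : Store} {nn q N : ℕ} (h4 : s.reg 4 = 1) (h9 : s.reg 9 = 0)
    (h5 : s.reg 5 = nn) (h6 : s.reg 6 = q) (h7 : s.reg 7 = N) (hq : 0 < q)
    (h0 : ∀ p, s.mem 1 p = 0) :
    ∀ j < nn, ColumnInv ((columnLoop.eval s).mem 1) ((columnLoop.eval s).mem 2) nn q j N := by
  -- The induction also needs that the rows of columns not yet treated are still zero.
  have main : (∀ j < nn, ColumnInv ((columnLoop.eval s).mem 1) ((columnLoop.eval s).mem 2) nn q j N)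
      ∧ ∀ j < nn, nn ≤ j → ∀ i < nn, (columnLoop.eval s).mem 1 (j * nn + i) = 0 := by
    have := eval_loop_induct (s := s) (x := 15) (y := 5) (p := .seq (mulAdd 18 15 5 9) symbolLoop)
      (fun J s' => (∀ j < J, ColumnInv (s'.mem 1) (s'.mem 2) nn q j N) ∧
        ∀ j < nn, J ≤ j → ∀ i < nn, s'.mem 1 (j * nn + i) = 0) (by decide)
      (by simp [h0]) ?_
    · rwa [h5] at this
    intro J hJ s' hj hr hm ⟨inv, hz⟩
    rw [h5] at hJ
    have h9' : s'.reg 9 = 0 := by rw [hr 9 (by decide), h9]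
    have h5' : s'.reg 5 = nn := by rw [hr 5 (by decide), h5]
    set s₁ := (mulAdd 18 15 5 9).eval s' with hs₁
    have r₁ : ∀ r, r ≠ 18 → r ≠ 14 → s₁.reg r = s'.reg r := fun r hr hr' =>
      reg_mulAdd_of_ne hr hr'
    have m₁ : s₁.mem = s'.mem := mem_mulAdd
    have h18 : s₁.reg 18 = J * nn := by
      rw [hs₁, reg_mulAdd h9' (by decide) (by decide) (by decide) (by decide), hj, h5', h9',
        add_zero]
    obtain ⟨inv', hy, hcode⟩ := symbolLoop_spec (s := s₁) (nn := nn) (q := q) (N := N) (j := J)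
      (by rw [r₁ 4 (by decide) (by decide), hr 4 (by decide), h4])
      (by rw [r₁ 9 (by decide) (by decide), h9'])
      (by rw [r₁ 5 (by decide) (by decide), h5'])
      (by rw [r₁ 6 (by decide) (by decide), hr 6 (by decide), h6])
      (by rw [r₁ 7 (by decide) (by decide), hr 7 (by decide), h7])
      (by rw [r₁ 15 (by decide) (by decide), hj]) h18 hq hJ
      (fun l hl i hi => by rw [m₁]; exact (inv i hi).lt l hl)
      (fun i hi => by rw [m₁]; exact hz J hJ le_rfl i hi)
    rw [m₁] at hy hcode
    simp only [Store.mem_setReg, eval]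
    rw [← hs₁]
    refine ⟨fun j hjJ => ?_, fun j hjn hjJ i hi => ?_⟩
    · rcases Nat.lt_succ_iff_lt_or_eq.1 hjJ with h | rfl
      · have old := inv j h
        refine ⟨fun l hl => ?_, fun i hi => ?_, fun i hi hji => ?_, ?_⟩
        · rw [hcode l j (by omega) (by omega)]; exact old.lt l hl
        · rw [hy j i (by omega) (by omega), old.pow i hi]
          congr 1
          exact agree_congr (fun l _ => (hcode l i (by omega) (by omega)).symm)
            (fun l _ => (hcode l j (by omega) (by omega)).symm)
        · rw [hy j i (by omega) hi]; exact old.zero i hi hji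
        · rw [Finset.sum_congr rfl fun i hi => by
            rw [hy j i (by omega) (by have := Finset.mem_range.1 hi; omega)]]
          exact old.sum
      · exact inv'
    · rw [hy j i (by omega) hi]; exact hz j hjn (by omega) i hi
  exact main.1

/-! ### Row sums, selection of columns and output of the matrix. -/

def rowSumInner : Cmd :=
  .loop 17 5 (.seq (.add 20 18 17) (.seq (.load 21 1 20) (.seq (.add 26 26 21)
    (.seq (mulAdd 20 17 5 15) (.seq (.load 21 1 20) (.add 26 26 21))))))

def rowSumLoop : Cmd :=
  .loop 15 5 (.seq (mulAdd 18 15 5 9) (.seq (.const 26 0) (.seq rowSumInner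
    (.seq (.store 5 15 26) (.add 27 27 26)))))

/-- Drop the columns whose agreement with the others is more than twice the average. -/
def selectLoop : Cmd :=
  .loop 15 5 (.seq (.load 26 5 15) (.seq (mulAdd 29 26 10 9)
    (.ifLt 27 29 .skip (.seq (.store 4 28 15) (.add 28 28 4)))))

/-- Writes a one in row `l * q + (symbol)` for each of the first `n` selected columns; zeros are
already there. -/
def outputInner : Cmd :=
  .loop 17 10 (.seq (.load 20 4 17) (.seq (.add 20 19 20) (.seq (.load 22 2 20)
    (.seq (.add 22 30 22) (.seq (mulAdd 20 22 10 17) (.store 0 20 4))))))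

def outputLoop : Cmd :=
  .loop 16 7 (.seq (mulAdd 19 16 5 9) (.seq (mulAdd 30 16 6 9) outputInner))

/-- The sum of the row `j` of a square array and its transpose. -/
def symmRowSum (y : ℕ → ℕ) (nn j : ℕ) : ℕ :=
  ∑ i ∈ Finset.range nn, (y (j * nn + i) + y (i * nn + j))

theorem rowSumInner_spec {s : Store} (h9 : s.reg 9 = 0) (h26 : s.reg 26 = 0)
    (h18 : s.reg 18 = s.reg 15 * s.reg 5) :
    (rowSumInner.eval s).reg 26 = symmRowSum (s.mem 1) (s.reg 5) (s.reg 15) := by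
  refine eval_loop_induct (fun j s' => s'.reg 26 = ∑ i ∈ Finset.range j,
    (s.mem 1 (s.reg 15 * s.reg 5 + i) + s.mem 1 (i * s.reg 5 + s.reg 15))) (by decide)
    (by simp [h26]) ?_
  intro j _ s' hj hr hm hI
  have g9 := hr 9 (by decide)
  have g5 := hr 5 (by decide)
  have g15 := hr 15 (by decide)
  have g18 := hr 18 (by decide)
  have m1 := hm 1 (by decide)
  rw [Finset.sum_range_succ, ← hI]
  simp only [eval]
  set s₁ := ((s'.setReg 20 (s'.reg 18 + s'.reg 17)).setReg 21
    ((s'.setReg 20 (s'.reg 18 + s'.reg 17)).mem 1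
      ((s'.setReg 20 (s'.reg 18 + s'.reg 17)).reg 20))) with hs₁
  set s₂ := s₁.setReg 26 (s₁.reg 26 + s₁.reg 21) with hs₂
  have e20 : ((mulAdd 20 17 5 15).eval s₂).reg 20 = j * s.reg 5 + s.reg 15 := by
    rw [reg_mulAdd (by simp [hs₂, hs₁, g9, h9]) (by decide) (by decide) (by decide) (by decide)]
    simp [hs₂, hs₁, hj, g5, g15]
  have e26 : ((mulAdd 20 17 5 15).eval s₂).reg 26 =
      s'.reg 26 + s.mem 1 (s.reg 15 * s.reg 5 + j) := by
    rw [reg_mulAdd_of_ne (by decide) (by decide)]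
    simp [hs₂, hs₁, hj, g18, m1, h18]
  simp only [Store.reg_setReg, e20, e26, mem_mulAdd]
  simp [hs₂, hs₁, m1, add_assoc]

theorem rowSumLoop_spec {s : Store} (h9 : s.reg 9 = 0) (h27 : s.reg 27 = 0) :
    (∀ j < s.reg 5, (rowSumLoop.eval s).mem 5 j = symmRowSum (s.mem 1) (s.reg 5) j) ∧
    (rowSumLoop.eval s).reg 27 =
      ∑ j ∈ Finset.range (s.reg 5), symmRowSum (s.mem 1) (s.reg 5) j := by
  refine eval_loop_induct (fun J s' => (∀ j < J, s'.mem 5 j = symmRowSum (s.mem 1) (s.reg 5) j) ∧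
    s'.reg 27 = ∑ j ∈ Finset.range J, symmRowSum (s.mem 1) (s.reg 5) j) (by decide)
    (by simp [h27]) ?_
  intro J _ s' hj hr hm ⟨h1, h2⟩
  have g9 : s'.reg 9 = 0 := by rw [hr 9 (by decide), h9]
  have g5 := hr 5 (by decide)
  have m1 := hm 1 (by decide)
  set s₁ := ((mulAdd 18 15 5 9).eval s').setReg 26 0 with hs₁
  have r₁ : ∀ r, r ≠ 18 → r ≠ 14 → r ≠ 26 → s₁.reg r = s'.reg r := fun r hr hr' hr'' => by
    rw [hs₁, Store.reg_setReg, if_neg hr'', reg_mulAdd_of_ne hr hr']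
  have m₁ : s₁.mem = s'.mem := by rw [hs₁, Store.mem_setReg, mem_mulAdd]
  have e15 : s₁.reg 15 = J := by rw [r₁ 15 (by decide) (by decide) (by decide), hj]
  have e5 : s₁.reg 5 = s.reg 5 := by rw [r₁ 5 (by decide) (by decide) (by decide), g5]
  have e18 : s₁.reg 18 = J * s.reg 5 := by
    rw [hs₁, Store.reg_setReg, if_neg (by decide),
      reg_mulAdd g9 (by decide) (by decide) (by decide) (by decide), hj, g5, g9, add_zero]
  have key := rowSumInner_spec (s := s₁) (by rw [r₁ 9 (by decide) (by decide) (by decide), g9])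
    (by simp [hs₁]) (by rw [e18, e15, e5])
  rw [m₁, m1, e5, e15] at key
  simp only [eval]
  rw [← hs₁]
  have f15 : (rowSumInner.eval s₁).reg 15 = J := by rw [eval_reg_of_notMem (by decide), e15]
  have f27 : (rowSumInner.eval s₁).reg 27 = s'.reg 27 := by
    rw [eval_reg_of_notMem (by decide), r₁ 27 (by decide) (by decide) (by decide)]
  have f5 : (rowSumInner.eval s₁).mem 5 = s'.mem 5 := by
    rw [eval_mem_of_notMem (by decide), m₁]
  constructor
  · intro j hjJ
    simp only [Store.mem_setReg, Store.mem_setMem, if_true, f15, f5, key]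
    split_ifs with h
    · rw [h]
    · exact h1 j (by omega)
  · rw [Finset.sum_range_succ, ← h2]
    simp [f27, key]

/-- Strict monotonicity of the selected indices is what makes the kept columns distinct. -/
theorem selectLoop_spec {s : Store} (h4 : s.reg 4 = 1) (h9 : s.reg 9 = 0) (h28 : s.reg 28 = 0) :
    (selectLoop.eval s).reg 28 = ((Finset.range (s.reg 5)).filter fun j =>
      s.mem 5 j * s.reg 10 ≤ s.reg 27).card ∧
    (∀ g < (selectLoop.eval s).reg 28, (selectLoop.eval s).mem 4 g < s.reg 5 ∧
      s.mem 5 ((selectLoop.eval s).mem 4 g) * s.reg 10 ≤ s.reg 27) ∧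
    ∀ g g', g < g' → g' < (selectLoop.eval s).reg 28 →
      (selectLoop.eval s).mem 4 g < (selectLoop.eval s).mem 4 g' := by
  refine eval_loop_induct (fun J s' => s'.reg 28 = ((Finset.range J).filter fun j =>
      s.mem 5 j * s.reg 10 ≤ s.reg 27).card ∧
    (∀ g < s'.reg 28, s'.mem 4 g < J ∧ s.mem 5 (s'.mem 4 g) * s.reg 10 ≤ s.reg 27) ∧
    ∀ g g', g < g' → g' < s'.reg 28 → s'.mem 4 g < s'.mem 4 g') (by decide) (by simp [h28]) ?_
  intro J _ s' hj hr hm ⟨h1, h2, h3⟩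
  have g9 : s'.reg 9 = 0 := by rw [hr 9 (by decide), h9]
  have g4 : s'.reg 4 = 1 := by rw [hr 4 (by decide), h4]
  have g10 := hr 10 (by decide)
  have g27 := hr 27 (by decide)
  have m5 := hm 5 (by decide)
  set s₁ := (mulAdd 29 26 10 9).eval (s'.setReg 26 (s.mem 5 J)) with hs₁
  have r₁ : ∀ r, r ≠ 29 → r ≠ 14 → r ≠ 26 → s₁.reg r = s'.reg r := fun r hr hr' hr'' => by
    rw [hs₁, reg_mulAdd_of_ne hr hr', Store.reg_setReg, if_neg hr'']
  have m₁ : s₁.mem = s'.mem := by rw [hs₁, mem_mulAdd, Store.mem_setReg]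
  have e29 : s₁.reg 29 = s.mem 5 J * s.reg 10 := by
    rw [hs₁, reg_mulAdd (by simp [g9]) (by decide) (by decide) (by decide) (by decide)]
    simp [g10, g9]
  have e27 : s₁.reg 27 = s.reg 27 := by rw [r₁ 27 (by decide) (by decide) (by decide), g27]
  have e28 : s₁.reg 28 = s'.reg 28 := r₁ 28 (by decide) (by decide) (by decide)
  have e15 : s₁.reg 15 = J := by rw [r₁ 15 (by decide) (by decide) (by decide), hj]
  have e4 : s₁.reg 4 = 1 := by rw [r₁ 4 (by decide) (by decide) (by decide), g4]
  simp only [eval, hj, m5]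
  rw [← hs₁, e27, e29, Finset.range_add_one, Finset.filter_insert]
  by_cases hgood : s.mem 5 J * s.reg 10 ≤ s.reg 27
  · rw [if_neg (not_lt.2 hgood), if_pos hgood, Finset.card_insert_of_notMem (by simp), ← h1]
    simp only [Store.reg_setReg, Store.mem_setReg, Store.reg_setMem, Store.mem_setMem,
      Nat.reduceEqDiff, if_false, if_true, e28, e4, e15, m₁]
    refine ⟨trivial, fun g hg => ?_, fun g g' hgg' hg' => ?_⟩
    · split_ifs with h
      · exact ⟨by omega, hgood⟩
      · exact ⟨(h2 g (by omega)).1.trans (by omega), (h2 g (by omega)).2⟩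
    · rw [if_neg (show g ≠ s'.reg 28 by omega)]
      split_ifs with h
      · exact (h2 g (by omega)).1
      · exact h3 g g' hgg' (by omega)
  · rw [if_pos (not_le.1 hgood), if_neg hgood, ← h1]
    simp only [Store.reg_setReg, Store.mem_setReg, Nat.reduceEqDiff, if_false, e28, m₁]
    exact ⟨trivial, fun g hg => ⟨(h2 g hg).1.trans (by omega), (h2 g hg).2⟩, h3⟩

theorem outputInner_spec {s : Store} (h4 : s.reg 4 = 1) (h9 : s.reg 9 = 0) (p : ℕ) :
    ((∃ g < s.reg 10, p = (s.reg 30 + s.mem 2 (s.reg 19 + s.mem 4 g)) * s.reg 10 + g) →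
      (outputInner.eval s).mem 0 p = 1) ∧
    ((¬ ∃ g < s.reg 10, p = (s.reg 30 + s.mem 2 (s.reg 19 + s.mem 4 g)) * s.reg 10 + g) →
      (outputInner.eval s).mem 0 p = s.mem 0 p) := by
  refine eval_loop_induct (fun J s' =>
    ((∃ g < J, p = (s.reg 30 + s.mem 2 (s.reg 19 + s.mem 4 g)) * s.reg 10 + g) →
      s'.mem 0 p = 1) ∧
    ((¬ ∃ g < J, p = (s.reg 30 + s.mem 2 (s.reg 19 + s.mem 4 g)) * s.reg 10 + g) →
      s'.mem 0 p = s.mem 0 p)) (by decide) (by simp) ?_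
  intro J _ s' hj hr hm ⟨h1, h2⟩
  have g9 : s'.reg 9 = 0 := by rw [hr 9 (by decide), h9]
  have g4 : s'.reg 4 = 1 := by rw [hr 4 (by decide), h4]
  have g10 := hr 10 (by decide)
  have g19 := hr 19 (by decide)
  have g30 := hr 30 (by decide)
  have m2 := hm 2 (by decide)
  have m4 := hm 4 (by decide)
  set x := s.reg 30 + s.mem 2 (s.reg 19 + s.mem 4 J) with hx
  have hmem : ∀ p, ((eval (.seq (.load 20 4 17) (.seq (.add 20 19 20) (.seq (.load 22 2 20)
      (.seq (.add 22 30 22) (.seq (mulAdd 20 22 10 17) (.store 0 20 4)))))) s').setReg 17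
        (J + 1)).mem 0 p = if p = x * s.reg 10 + J then 1 else s'.mem 0 p := by
    intro p
    simp only [Store.mem_setReg]
    simp only [eval]
    rw [Store.mem_setMem, if_pos rfl, reg_mulAdd (by simp [g9]) (by decide) (by decide) (by decide)
      (by decide), reg_mulAdd_of_ne (by decide) (by decide), mem_mulAdd]
    simp [hj, g4, g10, g19, g30, m2, m4, ← hx]
  rw [hmem]
  constructor
  · rintro ⟨g, hg, hp⟩
    rcases Nat.lt_succ_iff_lt_or_eq.1 hg with h | rfl
    · split_ifs
      · rfl
      · exact h1 ⟨g, h, hp⟩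
    · rw [if_pos hp]
  · intro h
    rw [if_neg fun h' => h ⟨J, by omega, h'⟩]
    exact h2 fun ⟨g, hg, hp⟩ => h ⟨g, by omega, hp⟩

theorem outputLoop_spec {s : Store} {n nn q N : ℕ} (h4 : s.reg 4 = 1) (h9 : s.reg 9 = 0)
    (h5 : s.reg 5 = nn) (h6 : s.reg 6 = q) (h7 : s.reg 7 = N) (h10 : s.reg 10 = n)
    (h0 : ∀ p, s.mem 0 p = 0) (p : ℕ) :
    ((∃ l < N, ∃ g < n, p = (l * q + s.mem 2 (l * nn + s.mem 4 g)) * n + g) →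
      (outputLoop.eval s).mem 0 p = 1) ∧
    ((¬ ∃ l < N, ∃ g < n, p = (l * q + s.mem 2 (l * nn + s.mem 4 g)) * n + g) →
      (outputLoop.eval s).mem 0 p = 0) := by
  subst h7
  refine eval_loop_induct (fun L s' =>
    ((∃ l < L, ∃ g < n, p = (l * q + s.mem 2 (l * nn + s.mem 4 g)) * n + g) →
      s'.mem 0 p = 1) ∧
    ((¬ ∃ l < L, ∃ g < n, p = (l * q + s.mem 2 (l * nn + s.mem 4 g)) * n + g) →
      s'.mem 0 p = 0)) (by decide) (by simp [h0]) ?_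
  intro L _ s' hl hr hm ⟨h1, h2⟩
  have g9 : s'.reg 9 = 0 := by rw [hr 9 (by decide), h9]
  have g4 : s'.reg 4 = 1 := by rw [hr 4 (by decide), h4]
  have g5 := hr 5 (by decide)
  have g6 := hr 6 (by decide)
  have g10 := hr 10 (by decide)
  have m2 := hm 2 (by decide)
  have m4 := hm 4 (by decide)
  set s₁ := (mulAdd 30 16 6 9).eval ((mulAdd 19 16 5 9).eval s') with hs₁
  have r₁ : ∀ r, r ≠ 19 → r ≠ 30 → r ≠ 14 → s₁.reg r = s'.reg r := fun r hr hr' hr'' => by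
    rw [hs₁, reg_mulAdd_of_ne hr' hr'', reg_mulAdd_of_ne hr hr'']
  have m₁ : s₁.mem = s'.mem := by rw [hs₁, mem_mulAdd, mem_mulAdd]
  have e19 : s₁.reg 19 = L * nn := by
    rw [hs₁, reg_mulAdd_of_ne (by decide) (by decide),
      reg_mulAdd g9 (by decide) (by decide) (by decide) (by decide), hl, g5, g9, h5, add_zero]
  have e30 : s₁.reg 30 = L * q := by
    have : ∀ r, r ≠ 19 → r ≠ 14 → ((mulAdd 19 16 5 9).eval s').reg r = s'.reg r :=
      fun r hr hr' => reg_mulAdd_of_ne hr hr'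
    rw [hs₁, reg_mulAdd (by rw [this 9 (by decide) (by decide), g9]) (by decide) (by decide)
      (by decide) (by decide), this 16 (by decide) (by decide), this 6 (by decide) (by decide),
      this 9 (by decide) (by decide), hl, g6, g9, h6, add_zero]
  have key := outputInner_spec (s := s₁)
    (by rw [r₁ 4 (by decide) (by decide) (by decide), g4])
    (by rw [r₁ 9 (by decide) (by decide) (by decide), g9]) p
  rw [e19, e30, m₁, m2, m4, r₁ 10 (by decide) (by decide) (by decide), g10, h10] at key
  simp only [Store.mem_setReg, eval]
  rw [← hs₁]
  by_cases hp : ∃ g < n, p = (L * q + s.mem 2 (L * nn + s.mem 4 g)) * n + g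
  · rw [key.1 hp]
    refine ⟨fun _ => rfl, fun h => absurd ?_ h⟩
    obtain ⟨g, hg, hp⟩ := hp
    exact ⟨L, by omega, g, hg, hp⟩
  · rw [key.2 hp]
    constructor
    · rintro ⟨l, hl, g, hg, hpg⟩
      rcases Nat.lt_succ_iff_lt_or_eq.1 hl with h | rfl
      · exact h1 ⟨l, h, g, hg, hpg⟩
      · exact absurd ⟨g, hg, hpg⟩ hp
    · rintro h
      exact h2 fun ⟨l, hl, g, hg, hpg⟩ => h ⟨l, by omega, g, hg, hpg⟩

/-! ### The parameters -/

/-- `r[5] := 2 * n`, `r[6] := 16 * k`. -/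
def sizes : Cmd :=
  .seq (.add 10 0 9) (.seq (.add 5 0 0) (.seq (.add 6 1 1) (.seq (.add 6 6 6) (.seq (.add 6 6 6)
    (.add 6 6 6)))))

/-- Doubles `a` until it reaches `b * n`, counting the doublings in register `12`. The cap of `2 *
n` rounds keeps the running time and the code length polynomial in `n` however small `a / b` is. -/
def doublingLoop : Cmd :=
  .loop 15 5 (.ifLt 11 13 (.seq (.add 11 11 11) (.add 12 12 4)) .skip)

/-- Length of the code and number of rows. -/
def lengths : Cmd :=
  -- The second factor bounds the loop, so `b * n` is formed in `n` rounds, independently of the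
  -- size of `b`.
  .seq (mulAdd 13 3 10 9) (.seq (.add 11 2 9) (.seq (.const 12 0) (.seq doublingLoop
    (.seq (.add 7 12 12) (mulAdd 8 7 6 9)))))

/-- The code, the selection of columns and the measurement matrix. -/
def construct : Cmd :=
  .seq columnLoop (.seq (.const 27 0) (.seq rowSumLoop (.seq (.const 28 0) (.seq selectLoop
    (.seq outputLoop (.add 0 8 9))))))

theorem doublingLoop_spec {s : Store} (h4 : s.reg 4 = 1) (h12 : s.reg 12 = 0) :
    (doublingLoop.eval s).reg 12 ≤ s.reg 5 ∧
    ((doublingLoop.eval s).reg 12 = s.reg 5 ∨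
      s.reg 13 ≤ 2 ^ (doublingLoop.eval s).reg 12 * s.reg 11) ∧
    ((doublingLoop.eval s).reg 12 = 0 ∨
      2 ^ (doublingLoop.eval s).reg 12 * s.reg 11 < 2 * s.reg 13) := by
  have := eval_loop_induct (s := s) (x := 15) (y := 5)
    (p := .ifLt 11 13 (.seq (.add 11 11 11) (.add 12 12 4)) .skip) (fun u s' =>
      s'.reg 11 = 2 ^ s'.reg 12 * s.reg 11 ∧ s'.reg 12 ≤ u ∧
      (s'.reg 12 = u ∨ s.reg 13 ≤ s'.reg 11) ∧ (s'.reg 12 = 0 ∨ s'.reg 11 < 2 * s.reg 13))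
    (by decide) (by simp [h12]) ?_
  · obtain ⟨h1, h2, h3, h4⟩ := this
    rw [h1] at h3 h4
    exact ⟨h2, h3, h4⟩
  intro u _ s' hu hr hm ⟨h1, h2, h3, h4'⟩
  have g13 := hr 13 (by decide)
  have g4 : s'.reg 4 = 1 := by rw [hr 4 (by decide), h4]
  simp only [eval, g13]
  split_ifs with hlt
  · simp only [Store.reg_setReg, Nat.reduceEqDiff, if_false, if_true, g4]
    refine ⟨by rw [pow_succ, h1]; ring, by omega, by omega, by omega⟩
  · simp only [Store.reg_setReg, Nat.reduceEqDiff, if_false]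
    exact ⟨h1, by omega, by omega, h4'⟩

end Cmd
end RAM

/-! ### Maclaurin's inequality and random unions of columns -/

/-- The elementary symmetric functions of the values of `x` on `s`. -/
def elemSymm {ι : Type*} (x : ι → ℝ) (s : Finset ι) (k : ℕ) : ℝ :=
  ∑ T ∈ s.powersetCard k, ∏ i ∈ T, x i

theorem elemSymm_nonneg {ι : Type*} {x : ι → ℝ} (hx : ∀ i, 0 ≤ x i) (s : Finset ι) (k : ℕ) :
    0 ≤ elemSymm x s k :=
  Finset.sum_nonneg fun _ _ => Finset.prod_nonneg fun i _ => hx i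

theorem elemSymm_insert {ι : Type*} [DecidableEq ι] (x : ι → ℝ) {s : Finset ι} {i : ι}
    (hi : i ∉ s) (k : ℕ) :
    elemSymm x (insert i s) (k + 1) = elemSymm x s (k + 1) + x i * elemSymm x s k := by
  unfold elemSymm
  rw [Finset.powersetCard_succ_insert hi, Finset.sum_union, Finset.sum_image, Finset.mul_sum]
  · congr 1
    refine Finset.sum_congr rfl fun T hT => ?_
    rw [Finset.prod_insert fun h => hi ((Finset.mem_powersetCard.1 hT).1 h)]
  · intro T hT U hU h
    have hT' : i ∉ T := fun h => hi ((Finset.mem_powersetCard.1 hT).1 h)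
    have hU' : i ∉ U := fun h => hi ((Finset.mem_powersetCard.1 hU).1 h)
    rw [← Finset.erase_insert hT', ← Finset.erase_insert hU', h]
  · rw [Finset.disjoint_left]
    intro T hT hT'
    obtain ⟨U, _, rfl⟩ := Finset.mem_image.1 hT'
    exact hi ((Finset.mem_powersetCard.1 hT).1 (Finset.mem_insert_self i U))

/-- Double counting: a `k`-subset `T` survives the erasure of exactly the `s.card - k` indices
outside it. -/
theorem sum_elemSymm_erase {ι : Type*} [DecidableEq ι] (x : ι → ℝ) (s : Finset ι) (k : ℕ) :
    ∑ i ∈ s, elemSymm x (s.erase i) k = (s.card - k : ℝ) * elemSymm x s k := by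
  unfold elemSymm
  rw [Finset.sum_comm' (t' := s.powersetCard k) (s' := fun T => s \ T), Finset.mul_sum]
  · refine Finset.sum_congr rfl fun T hT => ?_
    obtain ⟨h1, h2⟩ := Finset.mem_powersetCard.1 hT
    rw [Finset.sum_const, Finset.card_sdiff_of_subset h1, nsmul_eq_mul,
      Nat.cast_sub (Finset.card_le_card h1), h2]
  · intro i T
    simp only [Finset.mem_powersetCard, Finset.mem_sdiff, Finset.subset_erase]
    tauto

/-- Chebyshev's sum inequality: `x i` and `elemSymm x (s.erase i) k` are oppositely ordered, and
their products sum to `(k + 1) * elemSymm x s (k + 1)`. -/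
theorem card_mul_elemSymm_succ_le {ι : Type*} [DecidableEq ι] {x : ι → ℝ} (hx : ∀ i, 0 ≤ x i)
    (s : Finset ι) (k : ℕ) :
    s.card * ((k + 1) * elemSymm x s (k + 1)) ≤
      (∑ i ∈ s, x i) * ((s.card - k) * elemSymm x s k) := by
  have h1 : ∑ i ∈ s, x i * elemSymm x (s.erase i) k = (k + 1) * elemSymm x s (k + 1) := by
    have h := sum_elemSymm_erase x s (k + 1)
    have h' : ∑ i ∈ s, elemSymm x s (k + 1) =
        ∑ i ∈ s, (elemSymm x (s.erase i) (k + 1) + x i * elemSymm x (s.erase i) k) :=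
      Finset.sum_congr rfl fun i hi => by
        rw [← elemSymm_insert x (Finset.notMem_erase i s), Finset.insert_erase hi]
    rw [Finset.sum_const, nsmul_eq_mul, Finset.sum_add_distrib, h] at h'
    push_cast at h'
    linarith
  have hanti : AntivaryOn x (fun i => elemSymm x (s.erase i) k) s := by
    intro i hi j hj hij
    by_contra! hlt
    refine absurd hij (not_lt.2 ?_)
    have hne : i ≠ j := by rintro rfl; exact lt_irrefl _ hlt
    cases k with
    | zero => simp [elemSymm]
    | succ k =>
      have hi' : i ∉ (s.erase i).erase j := by simp
      have hj' : j ∉ (s.erase i).erase j := by simp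
      have e1 : s.erase i = insert j ((s.erase i).erase j) :=
        (Finset.insert_erase (Finset.mem_erase.2 ⟨hne.symm, hj⟩)).symm
      have e2 : s.erase j = insert i ((s.erase i).erase j) := by
        rw [Finset.erase_right_comm, Finset.insert_erase (Finset.mem_erase.2 ⟨hne, hi⟩)]
      change elemSymm x (s.erase j) (k + 1) ≤ elemSymm x (s.erase i) (k + 1)
      have e3 : elemSymm x (s.erase i) (k + 1) = _ :=
        (congrArg (elemSymm x · (k + 1)) e1).trans (elemSymm_insert x hj' k)
      rw [e2, elemSymm_insert x hi', e3]
      have := mul_le_mul_of_nonneg_right hlt.le (elemSymm_nonneg hx ((s.erase i).erase j) k)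
      linarith
  have h2 := hanti.card_mul_sum_le_sum_mul_sum
  rwa [h1, sum_elemSymm_erase] at h2

/-- Maclaurin's inequality between an elementary symmetric mean and the arithmetic mean. -/
theorem elemSymm_le {ι : Type*} [DecidableEq ι] {x : ι → ℝ} (hx : ∀ i, 0 ≤ x i)
    {s : Finset ι} (hs : s.Nonempty) (k : ℕ) :
    elemSymm x s k ≤ s.card.choose k * ((∑ i ∈ s, x i) / s.card) ^ k := by
  have hc : (0 : ℝ) < s.card := by exact_mod_cast hs.card_pos
  have hsum : 0 ≤ ∑ i ∈ s, x i := Finset.sum_nonneg fun i _ => hx i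
  induction k with
  | zero => simp [elemSymm]
  | succ k ih =>
    rcases le_or_gt s.card k with hk | hk
    · have : elemSymm x s (k + 1) = 0 := by
        rw [elemSymm, Finset.powersetCard_eq_empty.2 (by omega), Finset.sum_empty]
      rw [this]
      positivity
    · have h := card_mul_elemSymm_succ_le hx s k
      have hch : ((k : ℝ) + 1) * s.card.choose (k + 1) = (s.card - k) * s.card.choose k := by
        have := Nat.choose_succ_right_eq s.card k
        rw [← Nat.cast_sub hk.le, mul_comm, mul_comm (_ : ℝ) (s.card.choose k : ℝ)]
        exact_mod_cast this
      have hk' : (0 : ℝ) ≤ s.card - k := by rw [← Nat.cast_sub hk.le]; positivity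
      have hpos : (0 : ℝ) < s.card * (k + 1) := by positivity
      refine le_of_mul_le_mul_left ?_ hpos
      calc (s.card : ℝ) * (k + 1) * elemSymm x s (k + 1)
          ≤ (∑ i ∈ s, x i) * ((s.card - k) * elemSymm x s k) := by rw [mul_assoc]; exact h
        _ ≤ (∑ i ∈ s, x i) * ((s.card - k) *
              (s.card.choose k * ((∑ i ∈ s, x i) / s.card) ^ k)) := by gcongr
        _ = s.card * (((s.card - k) * s.card.choose k) * ((∑ i ∈ s, x i) / s.card) ^ (k + 1)) := by
            rw [pow_succ]; field_simp
        _ = _ := by rw [← hch]; ring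

/-- For a set `S` of columns whose symbols cover those of the column `j`, the numbers of agreements
of the columns in `S` with `j` sum up to at least the length. -/
theorem card_covered_column_le {n k N : ℕ} (col : ℕ → Fin n → ℕ) (j : Fin n) :
    (2 : ℝ) ^ N * (((Finset.univ : Finset (Fin n)).powersetCard k).filter fun S =>
      j ∉ S ∧ ∀ l < N, ∃ i ∈ S, col l i = col l j).card ≤
    n.choose k * (1 + (∑ i ∈ Finset.univ.erase j,
      ((2 : ℝ) ^ ((Finset.range N).filter fun l => col l i = col l j).card - 1)) / n) ^ k := by
  classical
  have hn : (0 : ℝ) < n := by exact_mod_cast Fin.pos j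
  set a : Fin n → ℕ := fun i => ((Finset.range N).filter fun l => col l i = col l j).card
  -- The value at `j` is a filler, as the sets counted avoid `j`; it allows Maclaurin over all of
  -- `Fin n`.
  set x : Fin n → ℝ := fun i => if i = j then 1 else 2 ^ a i with hxdef
  have hx : ∀ i, 0 ≤ x i := fun i => by simp only [hxdef]; split_ifs <;> positivity
  have hmac := elemSymm_le hx (⟨j, Finset.mem_univ j⟩ : (Finset.univ : Finset (Fin n)).Nonempty) k
  have hsum : ∑ i, x i = n + ∑ i ∈ Finset.univ.erase j, ((2 : ℝ) ^ a i - 1) := by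
    have hrest : ∑ i ∈ Finset.univ.erase j, x i =
        ∑ i ∈ Finset.univ.erase j, (((2 : ℝ) ^ a i - 1) + 1) :=
      Finset.sum_congr rfl fun i hi => by simp [hxdef, Finset.ne_of_mem_erase hi]
    rw [← Finset.add_sum_erase _ _ (Finset.mem_univ j), hrest, Finset.sum_add_distrib]
    simp only [hxdef, if_true, Finset.sum_const, Finset.card_erase_of_mem (Finset.mem_univ j),
      Finset.card_univ, Fintype.card_fin, nsmul_eq_mul, mul_one]
    rw [Nat.cast_sub (Fin.pos j)]
    push_cast
    ring
  rw [hsum, Finset.card_univ, Fintype.card_fin, add_div, div_self hn.ne'] at hmac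
  refine le_trans ?_ hmac
  rw [mul_comm, ← nsmul_eq_mul, ← Finset.sum_const, elemSymm]
  refine (Finset.sum_le_sum fun S hS => ?_).trans (Finset.sum_le_sum_of_subset_of_nonneg
    (Finset.filter_subset _ _) fun S _ _ => Finset.prod_nonneg fun i _ => hx i)
  obtain ⟨-, hj, hcov⟩ := Finset.mem_filter.1 hS
  have hprod : ∏ i ∈ S, x i = 2 ^ ∑ i ∈ S, a i := by
    rw [← Finset.prod_pow_eq_pow_sum]
    refine Finset.prod_congr rfl fun i hi => ?_
    simp only [hxdef]
    rw [if_neg (by rintro rfl; exact hj hi)]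
  rw [hprod]
  refine pow_le_pow_right₀ (by norm_num) ?_
  calc N = (Finset.range N).card := by simp
    _ ≤ (S.biUnion fun i => (Finset.range N).filter fun l => col l i = col l j).card := by
        refine Finset.card_le_card fun l hl => ?_
        obtain ⟨i, hi, h⟩ := hcov l (Finset.mem_range.1 hl)
        exact Finset.mem_biUnion.2 ⟨i, hi, Finset.mem_filter.2 ⟨hl, h⟩⟩
    _ ≤ ∑ i ∈ S, a i := Finset.card_biUnion_le

/-- If the columns agree pairwise about as rarely as random columns over an alphabet of `16 * k`
symbols, then few `k`-sets of columns cover another column. -/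
theorem card_covered_le {n k t : ℕ} (hk : 0 < k) (col : ℕ → Fin n → ℕ)
    (h : ∀ j, ∑ i ∈ Finset.univ.erase j,
      ((2 : ℝ) ^ ((Finset.range (2 * t)).filter fun l => col l i = col l j).card - 1) ≤
        4 * n * ((1 + 1 / (16 * k : ℝ)) ^ (2 * t) - 1)) :
    (2 : ℝ) ^ t * (((Finset.univ : Finset (Fin n)).powersetCard k).filter fun S =>
      ∃ j, j ∉ S ∧ ∀ l < 2 * t, ∃ i ∈ S, col l i = col l j).card ≤ n * n.choose k := by
  classical
  have hk' : (0 : ℝ) < k := by exact_mod_cast hk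
  set μ : ℝ := (1 + 1 / (16 * k : ℝ)) ^ (2 * t) with hμ
  have hμ1 : 1 ≤ μ := one_le_pow₀ (by simp)
  -- Here the alphabet size is used: `(1 + 1 / (16 * k)) ^ (16 * k) ≤ e ≤ 4`, and the exponent `8 *
  -- k * t` is half of `16 * k * t`, whence the squaring.
  have hexp : μ ^ (4 * k) ≤ 2 ^ t := by
    rw [hμ, ← pow_mul]
    have e1 : (1 + 1 / (16 * k : ℝ)) ^ (16 * k) ≤ 4 := by
      calc (1 + 1 / (16 * k : ℝ)) ^ (16 * k) ≤ (Real.exp (1 / (16 * k : ℝ))) ^ (16 * k) := by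
            gcongr
            rw [add_comm]
            exact Real.add_one_le_exp _
        _ = Real.exp 1 := by
            rw [← Real.exp_nat_mul]
            congr 1
            push_cast
            field_simp
        _ ≤ 4 := by linarith [Real.exp_one_lt_d9]
    refine le_of_sq_le_sq ?_ (by positivity)
    calc ((1 + 1 / (16 * k : ℝ)) ^ (2 * t * (4 * k))) ^ 2
        = ((1 + 1 / (16 * k : ℝ)) ^ (16 * k)) ^ t := by rw [← pow_mul, ← pow_mul]; ring_nf
      _ ≤ 4 ^ t := by gcongr
      _ = (2 ^ t) ^ 2 := by rw [← pow_mul, mul_comm, pow_mul]; norm_num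
  have hcol : ∀ j, (2 : ℝ) ^ t * (((Finset.univ : Finset (Fin n)).powersetCard k).filter fun S =>
      j ∉ S ∧ ∀ l < 2 * t, ∃ i ∈ S, col l i = col l j).card ≤ n.choose k := by
    intro j
    have hn : (0 : ℝ) < n := by exact_mod_cast Fin.pos j
    have hnn : 0 ≤ ∑ i ∈ Finset.univ.erase j,
        ((2 : ℝ) ^ ((Finset.range (2 * t)).filter fun l => col l i = col l j).card - 1) :=
      Finset.sum_nonneg fun i _ => sub_nonneg.2 (one_le_pow₀ (by norm_num))
    have hb := card_covered_column_le (k := k) (N := 2 * t) col j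
    -- Bernoulli absorbs the factor `4` lost by expurgation into the exponent.
    have hbern : 1 + 4 * (μ - 1) ≤ μ ^ 4 := by
      have := one_add_mul_le_pow (a := μ - 1) (by linarith) 4
      push_cast at this
      simpa using this
    -- Of the `2 ^ (2 * t)` gained from the length, one factor `2 ^ t` pays for the mean weight.
    refine le_of_mul_le_mul_left (le_trans (le_trans (le_of_eq ?_) hb) ?_)
      (show (0 : ℝ) < 2 ^ t by positivity)
    · rw [two_mul t, pow_add]
      ring
    · rw [mul_comm ((2 : ℝ) ^ t)]
      gcongr
      calc _ ≤ (1 + 4 * (μ - 1)) ^ k := by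
            gcongr
            rw [div_le_iff₀ hn]
            refine (h j).trans (le_of_eq (by ring))
        _ ≤ (μ ^ 4) ^ k := by gcongr
        _ = μ ^ (4 * k) := by rw [← pow_mul]
        _ ≤ _ := hexp
  calc (2 : ℝ) ^ t * (((Finset.univ : Finset (Fin n)).powersetCard k).filter fun S =>
      ∃ j, j ∉ S ∧ ∀ l < 2 * t, ∃ i ∈ S, col l i = col l j).card
      ≤ 2 ^ t * ∑ j : Fin n, (((Finset.univ : Finset (Fin n)).powersetCard k).filter fun S =>
          j ∉ S ∧ ∀ l < 2 * t, ∃ i ∈ S, col l i = col l j).card := by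
        gcongr
        refine le_trans (Finset.card_le_card fun S hS => ?_) Finset.card_biUnion_le
        obtain ⟨h1, j, h2⟩ := Finset.mem_filter.1 hS
        exact Finset.mem_biUnion.2 ⟨j, Finset.mem_univ j, Finset.mem_filter.2 ⟨h1, h2⟩⟩
    _ = ∑ j : Fin n, (2 : ℝ) ^ t * (((Finset.univ : Finset (Fin n)).powersetCard k).filter fun S =>
          j ∉ S ∧ ∀ l < 2 * t, ∃ i ∈ S, col l i = col l j).card := by
        push_cast
        rw [Finset.mul_sum]
    _ ≤ ∑ j : Fin n, (n.choose k : ℝ) := Finset.sum_le_sum fun j _ => hcol j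
    _ = _ := by simp

/-! ### Support recovery from nonnegative measurements -/

open scoped Pointwise in
/-- A uniformly random unit vector almost surely avoids finitely many hyperplanes. -/
theorem one_le_sphereLaw {ι κ : Type} [Fintype ι] [Nonempty ι] [Countable κ]
    (L : κ → EuclideanSpace ℝ ι →ₗ[ℝ] ℝ) (hL : ∀ c, L c ≠ 0) (A : Set (EuclideanSpace ℝ ι))
    (hA : ∀ y, (∀ c, L c y ≠ 0) → y ∈ A) : 1 ≤ sphereLaw ι A := by
  set σ := (volume : Measure (EuclideanSpace ℝ ι)).toSphere with hσ
  -- `A` need not be measurable: only this inequality is needed.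
  refine le_trans ?_ (Measure.le_map_apply (by fun_prop) A)
  have hnull : ∀ c, σ {v | L c v.1 = 0} = 0 := by
    intro c
    have hcl : IsClosed {v : Metric.sphere (0 : EuclideanSpace ℝ ι) 1 | L c v.1 = 0} :=
      isClosed_eq ((L c).continuous_of_finiteDimensional.comp continuous_subtype_val)
        continuous_const
    rw [hσ, Measure.toSphere_apply' _ hcl.measurableSet]
    -- The surface measure is defined through the cone, which lies in a proper subspace.
    have hsub : Set.Ioo (0 : ℝ) 1 • (Subtype.val ''
        {v : Metric.sphere (0 : EuclideanSpace ℝ ι) 1 | L c v.1 = 0}) ⊆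
        (LinearMap.ker (L c) : Set (EuclideanSpace ℝ ι)) := by
      rintro _ ⟨r, _, _, ⟨v, hv, rfl⟩, rfl⟩
      have hv' : L c v.1 = 0 := hv
      simp [hv']
    rw [measure_mono_null hsub, mul_zero]
    exact Measure.addHaar_submodule _ _ (by rw [Ne, LinearMap.ker_eq_top]; exact hL c)
  have hae : ∀ᵐ v ∂σ, v ∈ Subtype.val ⁻¹' A := by
    have : ∀ᵐ v ∂σ, ∀ c, L c v.1 ≠ 0 := by
      rw [ae_all_iff]
      intro c
      rw [ae_iff]
      simpa using hnull c
    filter_upwards [this] with v hv using hA _ hv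
  have hfull : σ (Subtype.val ⁻¹' A) = σ Set.univ := measure_eq_measure_of_null_sdiff
    (Set.subset_univ _) (by rw [← Set.compl_eq_univ_sdiff]; exact hae)
  rw [Measure.smul_apply, smul_eq_mul, hfull, ENNReal.inv_mul_cancel]
  · rw [Ne, Measure.measure_univ_eq_zero]
    exact Measure.toSphere_ne_zero _
  · exact measure_ne_top _ _

/-- The sum of the entries in `T`, as a linear functional. -/
def coordSum {ι : Type} [Fintype ι] (T : Finset ι) : EuclideanSpace ℝ ι →ₗ[ℝ] ℝ where
  toFun y := ∑ i ∈ T, y i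
  map_add' y z := by simp [Finset.sum_add_distrib]
  map_smul' r y := by simp [Finset.mul_sum]

theorem coordSum_ne_zero {ι : Type} [Fintype ι] {T : Finset ι} (hT : T.Nonempty) :
    coordSum T ≠ 0 := by
  classical
  obtain ⟨i, hi⟩ := hT
  intro h
  have := congrArg (fun f => f (EuclideanSpace.single i (1 : ℝ))) h
  simp [coordSum, hi] at this

theorem measurable_extendZero {n : ℕ} (S : Finset (Fin n)) : Measurable (extendZero S) := by
  unfold extendZero
  refine (WithLp.measurable_toLp 2 (Fin n → ℝ)).comp (measurable_pi_iff.2 fun i => ?_)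
  split_ifs with h <;> fun_prop

/-- The measurements of a vector supported on `S` by a matrix of zeros and ones. -/
theorem mulVec_extendZero {m n : ℕ} (M : Matrix (Fin m) (Fin n) ℝ)
    (hM : ∀ i j, M i j = 0 ∨ M i j = 1) (S : Finset (Fin n)) (y : EuclideanSpace ℝ S) (i : Fin m) :
    (M *ᵥ (extendZero S y).ofLp) i =
      coordSum (Finset.univ.filter fun j : S => M i j ≠ 0) y := by
  classical
  simp only [Matrix.mulVec, dotProduct, extendZero, coordSum, LinearMap.coe_mk, AddHom.coe_mk]
  rw [Finset.sum_filter, ← Finset.sum_subset (Finset.subset_univ S)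
    (fun j _ hj => by simp [hj]), ← Finset.sum_coe_sort S]
  refine Finset.sum_congr rfl fun j _ => ?_
  rcases hM i j with h | h <;> simp [h]

/-- If a fraction at least `1 - δ` of all `k`-sets `S` is such that every column outside `S` has a
one in a row where all columns in `S` vanish, then the support of the random signal can be recovered
with probability at least `1 - δ`. -/
theorem recoversRandomSupport_of_disjunct {m n k : ℕ} {δ : ℝ} (hk : 0 < k) (hkn : k ≤ n)
    (M : Matrix (Fin m) (Fin n) ℝ) (hM : ∀ i j, M i j = 0 ∨ M i j = 1)
    (G : Finset (Finset (Fin n))) (hG : G ⊆ Finset.univ.powersetCard k)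
    (hdis : ∀ S ∈ G, ∀ j ∉ S, ∃ i, M i j ≠ 0 ∧ ∀ h ∈ S, M i h = 0)
    (hcard : (1 - δ) * n.choose k ≤ G.card) :
    RecoversRandomSupport M k δ := by
  classical
  -- The decoder discards `j` as soon as a row containing `j` measures zero.
  refine ⟨fun z => {j | ∀ i, M i j ≠ 0 → z i ≠ 0}, ?_⟩
  set A : Set (EuclideanSpace ℝ (Fin n)) :=
    {x | {j | ∀ i, M i j ≠ 0 → signMeasurements M x i ≠ 0} = signalSupport x} with hA
  have hone : ∀ S ∈ G, 1 ≤ ((sphereLaw S).map (extendZero S)) A := by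
    intro S hS
    have hScard : S.card = k := (Finset.mem_powersetCard.1 (hG hS)).2
    have hne : S.Nonempty := Finset.card_pos.1 (by omega)
    have : Nonempty S := hne.to_subtype
    refine le_trans ?_ (Measure.le_map_apply (measurable_extendZero S).aemeasurable A)
    -- Singletons `T` make the support equal to `S`; the other `T` make every row that meets `S`
    -- measure nonzero.
    refine one_le_sphereLaw (fun T : {T : Finset S // T.Nonempty} => coordSum T.1)
      (fun T => coordSum_ne_zero T.2) _ fun y hy => ?_
    have hsupp : signalSupport (extendZero S y) = {j | j ∈ S} := by
      ext j
      simp only [signalSupport, extendZero, Set.mem_ofPred_eq]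
      by_cases hj : j ∈ S
      · have := hy ⟨{⟨j, hj⟩}, Finset.singleton_nonempty _⟩
        simpa [hj, coordSum] using this
      · simp [hj]
    change {j | ∀ i, M i j ≠ 0 → signMeasurements M (extendZero S y) i ≠ 0} =
      signalSupport (extendZero S y)
    rw [hsupp]
    ext j
    simp only [Set.mem_ofPred_eq, signMeasurements, ne_eq, sign_eq_zero_iff,
      mulVec_extendZero M hM]
    constructor
    · intro h
      by_contra hj
      obtain ⟨i, hi, hi'⟩ := hdis S hS j hj
      apply h i hi
      rw [Finset.filter_false_of_mem]
      · simp [coordSum]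
      · intro h _
        simpa using hi' h h.2
    · intro hj i hi
      exact hy ⟨_, ⟨⟨j, hj⟩, Finset.mem_filter.2 ⟨Finset.mem_univ _, hi⟩⟩⟩
  have hC : (0 : ℝ) < n.choose k := by exact_mod_cast Nat.choose_pos hkn
  have hsum : (G.card : ENNReal) ≤
      (∑ S ∈ (Finset.univ : Finset (Fin n)).powersetCard k,
        (sphereLaw S).map (extendZero S)) A := by
    rw [Measure.finsetSum_apply]
    calc (G.card : ENNReal) = ∑ S ∈ G, 1 := by simp
      _ ≤ ∑ S ∈ G, ((sphereLaw S).map (extendZero S)) A := Finset.sum_le_sum hone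
      _ ≤ _ := Finset.sum_le_sum_of_subset hG
  rw [signalLaw, Measure.smul_apply, smul_eq_mul]
  refine le_trans ?_ (mul_le_mul_right hsum _)
  rw [mul_comm, ← div_eq_mul_inv, ENNReal.le_div_iff_mul_le (.inl (by exact_mod_cast hC.ne'))
    (.inl (ENNReal.natCast_ne_top _)), ← ENNReal.ofReal_natCast, ← ENNReal.ofReal_natCast,
    ← ENNReal.ofReal_mul' hC.le]
  exact ENNReal.ofReal_le_ofReal hcard

namespace RAM
namespace Cmd

/-! ### Expurgation -/

/-- Markov's inequality: at most half of the `2 * n` values exceed twice their average. -/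
theorem le_card_filter_mul_le_sum (f : ℕ → ℕ) (n : ℕ) :
    n ≤ ((Finset.range (n + n)).filter fun j =>
      f j * n ≤ ∑ i ∈ Finset.range (n + n), f i).card := by
  set T := ∑ i ∈ Finset.range (n + n), f i with hT
  have hsplit := Finset.card_filter_add_card_filter_not (s := Finset.range (n + n))
    (fun j => f j * n ≤ T)
  rw [Finset.card_range] at hsplit
  by_contra! hlt
  set B := (Finset.range (n + n)).filter fun j => ¬ f j * n ≤ T with hB
  have h1 : B.card * (T + 1) ≤ T * n := by
    calc B.card * (T + 1) = ∑ _j ∈ B, (T + 1) := by simp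
      _ ≤ ∑ j ∈ B, f j * n := Finset.sum_le_sum fun j hj => by
          have := (Finset.mem_filter.1 hj).2
          omega
      _ = (∑ j ∈ B, f j) * n := by rw [Finset.sum_mul]
      _ ≤ T * n := Nat.mul_le_mul_right _ (Finset.sum_le_sum_of_subset (Finset.filter_subset _ _))
  have h2 : (n + 1) * (T + 1) ≤ B.card * (T + 1) := Nat.mul_le_mul_right _ (by omega)
  nlinarith

/-- Row `j` sums to at most `j * (μ - 1)`; symmetrising doubles the total, and `∑ 2 * j ≤ nn ^ 2`.
-/
theorem ColumnInv.sum_symmRowSum_le {y c : ℕ → ℕ} {nn q N : ℕ}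
    (hinv : ∀ j < nn, ColumnInv y c nn q j N) (hq : 0 < q) :
    ((∑ j ∈ Finset.range nn, symmRowSum y nn j : ℕ) : ℝ) ≤
      nn ^ 2 * ((1 + 1 / (q : ℝ)) ^ N - 1) := by
  have hq' : (0 : ℝ) < q := by exact_mod_cast hq
  set μ : ℝ := (1 + 1 / (q : ℝ)) ^ N with hμ
  have hμ1 : 1 ≤ μ := one_le_pow₀ (by simp)
  have hrow : ∀ j < nn, ((∑ i ∈ Finset.range nn, y (j * nn + i) : ℕ) : ℝ) ≤ j * (μ - 1) := by
    intro j hj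
    have hcut : ∑ i ∈ Finset.range nn, y (j * nn + i) = ∑ i ∈ Finset.range j, y (j * nn + i) := by
      refine (Finset.sum_subset (Finset.range_subset_range.2 hj.le) fun i hi hi' => ?_).symm
      simp only [Finset.mem_range] at hi hi'
      exact (hinv j hj).zero i hi (by omega)
    have hs := (hinv j hj).sum
    rw [Finset.sum_add_distrib, ← hcut] at hs
    simp only [Finset.sum_const, Finset.card_range, smul_eq_mul, mul_one] at hs
    have hs' : (q : ℝ) ^ N * ((∑ i ∈ Finset.range nn, y (j * nn + i) : ℕ) + j) ≤
        j * (q + 1) ^ N := by exact_mod_cast hs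
    have hμ' : ((q : ℝ) + 1) ^ N = q ^ N * μ := by
      rw [hμ, ← mul_pow]
      congr 1
      field_simp
    rw [hμ'] at hs'
    have : ((∑ i ∈ Finset.range nn, y (j * nn + i) : ℕ) : ℝ) + j ≤ j * μ := by
      refine le_of_mul_le_mul_left (hs'.trans (le_of_eq (by ring)))
        (show (0 : ℝ) < q ^ N by positivity)
    linarith
  have htwice : ∑ j ∈ Finset.range nn, symmRowSum y nn j =
      2 * ∑ j ∈ Finset.range nn, ∑ i ∈ Finset.range nn, y (j * nn + i) := by
    simp only [symmRowSum, Finset.sum_add_distrib]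
    rw [Finset.sum_comm (f := fun j i => y (i * nn + j))]
    ring
  have hgauss : ∑ j ∈ Finset.range nn, (j : ℝ) * 2 ≤ nn ^ 2 := by
    have := Finset.sum_range_id_mul_two nn
    rw [Finset.sum_mul] at this
    calc ∑ j ∈ Finset.range nn, (j : ℝ) * 2 = ((nn * (nn - 1) : ℕ) : ℝ) := by
          rw [← this]; push_cast; rfl
      _ ≤ ((nn * nn : ℕ) : ℝ) := by gcongr; omega
      _ = _ := by push_cast; ring
  rw [htwice]
  push_cast
  calc (2 : ℝ) * ∑ j ∈ Finset.range nn, ∑ i ∈ Finset.range nn, (y (j * nn + i) : ℝ)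
      ≤ 2 * ∑ j ∈ Finset.range nn, (j : ℝ) * (μ - 1) := by
        gcongr with j hj
        exact_mod_cast hrow j (Finset.mem_range.1 hj)
    _ = (∑ j ∈ Finset.range nn, (j : ℝ) * 2) * (μ - 1) := by
        rw [← Finset.sum_mul, ← Finset.sum_mul]; ring
    _ ≤ _ := by gcongr

/-- Of the two entries of a pair of columns, one is `2 ^ agree - 1` and the other zero; injectivity
of `sel` makes the left side a partial sum. -/
theorem ColumnInv.le_symmRowSum {y c : ℕ → ℕ} {nn q N : ℕ}
    (hinv : ∀ j < nn, ColumnInv y c nn q j N) {n : ℕ} {sel : Fin n → ℕ}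
    (hsel : Function.Injective sel) (hlt : ∀ g, sel g < nn) (g : Fin n) :
    ∑ h ∈ Finset.univ.erase g, ((2 : ℝ) ^ agree c nn N (sel h) (sel g) - 1) ≤
      symmRowSum y nn (sel g) := by
  classical
  have hterm : ∀ h ∈ Finset.univ.erase g, (2 : ℝ) ^ agree c nn N (sel h) (sel g) - 1 =
      ((y (sel g * nn + sel h) + y (sel h * nn + sel g) : ℕ) : ℝ) := by
    intro h hh
    have hne : sel h ≠ sel g := fun e => Finset.ne_of_mem_erase hh (hsel e)
    rcases lt_or_gt_of_ne hne with hl | hl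
    · have h1 := (hinv _ (hlt g)).pow _ hl
      have h2 := (hinv _ (hlt h)).zero _ (hlt g) hl.le
      have h1' : (y (sel g * nn + sel h) : ℝ) + 1 = 2 ^ agree c nn N (sel h) (sel g) := by
        exact_mod_cast h1
      rw [h2, ← h1']
      simp
    · have h1 := (hinv _ (hlt h)).pow _ hl
      have h2 := (hinv _ (hlt g)).zero _ (hlt h) hl.le
      have hsymm : agree c nn N (sel h) (sel g) = agree c nn N (sel g) (sel h) := by
        simp only [agree, eq_comm]
      have h1' : (y (sel h * nn + sel g) : ℝ) + 1 = 2 ^ agree c nn N (sel g) (sel h) := by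
        exact_mod_cast h1
      rw [h2, hsymm, ← h1']
      simp
  rw [Finset.sum_congr rfl hterm, ← Nat.cast_sum, Nat.cast_le]
  rw [← Finset.sum_image (g := sel) (s := Finset.univ.erase g)
    (f := fun i => y (sel g * nn + i) + y (i * nn + sel g)) fun _ _ _ _ e => hsel e]
  refine Finset.sum_le_sum_of_subset fun i hi => ?_
  obtain ⟨h, -, rfl⟩ := Finset.mem_image.1 hi
  exact Finset.mem_range.2 (hlt h)

/-! ### The algorithm -/

theorem sizes_spec {s : Store} (h9 : s.reg 9 = 0) :
    (sizes.eval s).reg 10 = s.reg 0 ∧ (sizes.eval s).reg 5 = s.reg 0 + s.reg 0 ∧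
      (sizes.eval s).reg 6 = 16 * s.reg 1 := by
  simp [sizes, eval, h9]
  ring

theorem lengths_spec {s : Store} (h4 : s.reg 4 = 1) (h9 : s.reg 9 = 0) :
    ∃ t ≤ s.reg 5, (lengths.eval s).reg 7 = 2 * t ∧ (lengths.eval s).reg 8 = 2 * t * s.reg 6 ∧
      (t = s.reg 5 ∨ s.reg 3 * s.reg 10 ≤ 2 ^ t * s.reg 2) ∧
      (t = 0 ∨ 2 ^ t * s.reg 2 < 2 * (s.reg 3 * s.reg 10)) := by
  set s₁ := (((mulAdd 13 3 10 9).eval s).setReg 11 (s.reg 2)).setReg 12 0 with hs₁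
  have r₁ : ∀ r, r ≠ 13 → r ≠ 14 → r ≠ 11 → r ≠ 12 → s₁.reg r = s.reg r :=
    fun r h h' h'' h''' => by simp [hs₁, h'', h''', reg_mulAdd_of_ne h h']
  have e13 : s₁.reg 13 = s.reg 3 * s.reg 10 := by
    simp [hs₁, reg_mulAdd h9, h9]
  have e11 : s₁.reg 11 = s.reg 2 := by simp [hs₁]
  have e5 : s₁.reg 5 = s.reg 5 := r₁ 5 (by decide) (by decide) (by decide) (by decide)
  have e6 : s₁.reg 6 = s.reg 6 := r₁ 6 (by decide) (by decide) (by decide) (by decide)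
  have e9 : s₁.reg 9 = 0 := by rw [r₁ 9 (by decide) (by decide) (by decide) (by decide), h9]
  have e4 : s₁.reg 4 = 1 := by rw [r₁ 4 (by decide) (by decide) (by decide) (by decide), h4]
  obtain ⟨h1, h2, h3⟩ := doublingLoop_spec e4 (by simp [hs₁])
  rw [e5, e13, e11] at *
  have hfin : lengths.eval s = (mulAdd 8 7 6 9).eval ((doublingLoop.eval s₁).setReg 7
      ((doublingLoop.eval s₁).reg 12 + (doublingLoop.eval s₁).reg 12)) := by
    simp [lengths, eval, hs₁, reg_mulAdd_of_ne, h9]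
  set t := (doublingLoop.eval s₁).reg 12
  have f9 : (doublingLoop.eval s₁).reg 9 = 0 := by rw [eval_reg_of_notMem (by decide), e9]
  have f6 : (doublingLoop.eval s₁).reg 6 = s.reg 6 := by
    rw [eval_reg_of_notMem (by decide), e6]
  refine ⟨t, h1, ?_, ?_, h2, h3⟩
  · rw [hfin, reg_mulAdd_of_ne (by decide) (by decide), Store.reg_setReg, if_pos rfl, two_mul]
  · rw [hfin, reg_mulAdd (by simp [f9]) (by decide) (by decide) (by decide) (by decide)]
    simp [f9, f6, two_mul]

/-- With `nn = 2 * n` the total is at most `4 * n ^ 2 * (μ - 1)`, `μ = (1 + 1 / q) ^ N`; selection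
divides it by `n`. -/
theorem construct_spec {s : Store} {n q N : ℕ} (h4 : s.reg 4 = 1) (h9 : s.reg 9 = 0)
    (h5 : s.reg 5 = n + n) (h6 : s.reg 6 = q) (h7 : s.reg 7 = N) (h10 : s.reg 10 = n) (hq : 0 < q)
    (hmem : ∀ a p, s.mem a p = 0) :
    (construct.eval s).reg 0 = s.reg 8 ∧ ∃ col : ℕ → Fin n → ℕ,
      (∀ l < N, ∀ g, col l g < q) ∧
      (∀ j, ∑ i ∈ Finset.univ.erase j,
        ((2 : ℝ) ^ ((Finset.range N).filter fun l => col l i = col l j).card - 1) ≤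
          4 * n * ((1 + 1 / (q : ℝ)) ^ N - 1)) ∧
      ∀ p, ((∃ l < N, ∃ g : Fin n, p = (l * q + col l g) * n + g) →
          (construct.eval s).mem 0 p = 1) ∧
        ((¬ ∃ l < N, ∃ g : Fin n, p = (l * q + col l g) * n + g) →
          (construct.eval s).mem 0 p = 0) := by
  set s₁ := columnLoop.eval s with hs₁
  have hinv := columnLoop_spec h4 h9 h5 h6 h7 hq (hmem 1)
  rw [← hs₁] at hinv
  have r₁ : ∀ r, r ∉ columnLoop.writes → s₁.reg r = s.reg r := fun r hr => eval_reg_of_notMem hr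
  set s₂ := rowSumLoop.eval (s₁.setReg 27 0) with hs₂
  have r₂ : ∀ r, r ∉ rowSumLoop.writes → r ≠ 27 → s₂.reg r = s₁.reg r := fun r hr hr' => by
    rw [hs₂, eval_reg_of_notMem hr, Store.reg_setReg, if_neg hr']
  have m₂ : ∀ a, a ≠ 5 → s₂.mem a = s₁.mem a := fun a ha => by
    rw [hs₂, eval_mem_of_notMem (by simp [rowSumLoop, rowSumInner, mulAdd, memWrites, ha]),
      Store.mem_setReg]
  obtain ⟨hrow, htot⟩ := rowSumLoop_spec (s := s₁.setReg 27 0)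
    (by simp [r₁ 9 (by decide), h9]) (by simp)
  rw [← hs₂] at hrow htot
  simp only [Store.mem_setReg, Store.reg_setReg, Nat.reduceEqDiff, if_false, r₁ 5 (by decide), h5]
    at hrow htot
  set s₃ := selectLoop.eval (s₂.setReg 28 0) with hs₃
  have r₃ : ∀ r, r ∉ selectLoop.writes → r ≠ 28 → s₃.reg r = s₂.reg r := fun r hr hr' => by
    rw [hs₃, eval_reg_of_notMem hr, Store.reg_setReg, if_neg hr']
  have m₃ : ∀ a, a ≠ 4 → s₃.mem a = s₂.mem a := fun a ha => by
    rw [hs₃, eval_mem_of_notMem (by simp [selectLoop, mulAdd, memWrites, ha]), Store.mem_setReg]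
  obtain ⟨hcnt, hgood, hmono⟩ := selectLoop_spec (s := s₂.setReg 28 0)
    (by simp [r₂ 4 (by decide), r₁ 4 (by decide), h4])
    (by simp [r₂ 9 (by decide), r₁ 9 (by decide), h9]) (by simp)
  rw [← hs₃] at hcnt hgood hmono
  simp only [Store.mem_setReg, Store.reg_setReg, Nat.reduceEqDiff, if_false,
    r₂ 5 (by decide) (by decide), r₁ 5 (by decide), h5, r₂ 10 (by decide) (by decide),
    r₁ 10 (by decide), h10, htot] at hcnt hgood
  have hn : n ≤ s₃.reg 28 := by
    rw [hcnt, Finset.filter_congr fun j hj => by rw [hrow j (Finset.mem_range.1 hj)]]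
    exact le_card_filter_mul_le_sum _ n
  have hsel : Function.Injective fun g : Fin n => s₃.mem 4 g := by
    intro g g' h
    rcases lt_trichotomy g g' with h' | h' | h'
    · exact absurd h (hmono g g' h' (by omega)).ne
    · exact h'
    · exact absurd h (hmono g' g h' (by omega)).ne'
  have hsellt : ∀ g : Fin n, s₃.mem 4 g < n + n := fun g => (hgood g (by omega)).1
  have hfin : construct.eval s = (outputLoop.eval s₃).setReg 0
      ((outputLoop.eval s₃).reg 8 + (outputLoop.eval s₃).reg 9) := by
    simp [construct, eval, hs₃, hs₂, hs₁]
  have g9 : s₃.reg 9 = 0 := by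
    rw [r₃ 9 (by decide) (by decide), r₂ 9 (by decide) (by decide), r₁ 9 (by decide), h9]
  refine ⟨?_, fun l g => s₁.mem 2 (l * (n + n) + s₃.mem 4 g), fun l hl g => ?_, fun j => ?_,
    fun p => ?_⟩
  · rw [hfin, Store.reg_setReg, if_pos rfl, eval_reg_of_notMem (c := outputLoop) (r := 8) (by decide),
      eval_reg_of_notMem (c := outputLoop) (r := 9) (by decide), g9, r₃ 8 (by decide) (by decide),
      r₂ 8 (by decide) (by decide), r₁ 8 (by decide), add_zero]
  · exact (hinv _ (hsellt g)).lt l hl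
  · have hle := ColumnInv.le_symmRowSum hinv hsel hsellt j
    have hsum := ColumnInv.sum_symmRowSum_le hinv hq
    have hg := (hgood j (by omega)).2
    rw [hrow _ (hsellt j)] at hg
    have hn' : (0 : ℝ) < n := by exact_mod_cast Fin.pos j
    have hg' : (symmRowSum (s₁.mem 1) (n + n) (s₃.mem 4 j) : ℝ) * n ≤
        ((∑ i ∈ Finset.range (n + n), symmRowSum (s₁.mem 1) (n + n) i : ℕ) : ℝ) := by
      exact_mod_cast hg
    refine hle.trans (le_of_mul_le_mul_right (hg'.trans (hsum.trans (le_of_eq ?_))) hn')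
    push_cast
    ring
  · have hout := outputLoop_spec (s := s₃) (n := n) (nn := n + n) (q := q) (N := N)
      (by rw [r₃ 4 (by decide) (by decide), r₂ 4 (by decide) (by decide), r₁ 4 (by decide), h4])
      g9
      (by rw [r₃ 5 (by decide) (by decide), r₂ 5 (by decide) (by decide), r₁ 5 (by decide), h5])
      (by rw [r₃ 6 (by decide) (by decide), r₂ 6 (by decide) (by decide), r₁ 6 (by decide), h6])
      (by rw [r₃ 7 (by decide) (by decide), r₂ 7 (by decide) (by decide), r₁ 7 (by decide), h7])
      (by rw [r₃ 10 (by decide) (by decide), r₂ 10 (by decide) (by decide), r₁ 10 (by decide),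
        h10])
      (fun p => by rw [m₃ 0 (by decide), m₂ 0 (by decide), hs₁, eval_mem_of_notMem (by decide),
        hmem]) p
    rw [m₃ 2 (by decide), m₂ 2 (by decide)] at hout
    rw [hfin, Store.mem_setReg]
    refine ⟨fun ⟨l, hl, g, hp⟩ => hout.1 ⟨l, hl, g, g.2, hp⟩, fun h => hout.2 ?_⟩
    rintro ⟨l, hl, g, hg, hp⟩
    exact h ⟨l, hl, ⟨g, hg⟩, hp⟩

end Cmd

open Cmd in
/-- The algorithm: sizes, lengths, code and matrix. -/
def matrixProg : Prog :=
  .seq (.const 4 1) (.seq sizes.compile (.seq lengths.compile construct.compile))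

open Cmd in
theorem exec_matrixProg : ∃ D c : ℕ, ∀ n k a b : ℕ, 0 < n → 0 < k →
    ∃ (T t : ℕ) (s : Store) (col : ℕ → Fin n → ℕ),
      Exec matrixProg (inputStore [n, k, a, b]) T s ∧ T ≤ D * (n + k) ^ c ∧
      (t = n + n ∨ b * n ≤ 2 ^ t * a) ∧ (t = 0 ∨ 2 ^ t * a < 2 * (b * n)) ∧
      outputRows s = 2 * t * (16 * k) ∧
      (∀ l < 2 * t, ∀ g, col l g < 16 * k) ∧
      (∀ j, ∑ i ∈ Finset.univ.erase j,
        ((2 : ℝ) ^ ((Finset.range (2 * t)).filter fun l => col l i = col l j).card - 1) ≤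
          4 * n * ((1 + 1 / (16 * k : ℝ)) ^ (2 * t) - 1)) ∧
      ∀ p, ((∃ l < 2 * t, ∃ g : Fin n, p = (l * (16 * k) + col l g) * n + g) → s.mem 0 p = 1) ∧
        ((¬ ∃ l < 2 * t, ∃ g : Fin n, p = (l * (16 * k) + col l g) * n + g) → s.mem 0 p = 0) := by
  obtain ⟨D, e, hcost⟩ := exists_cost_le (.seq sizes (.seq lengths construct))
  refine ⟨(D + 1) * 17 ^ e, e, fun n k a b hn hk => ?_⟩
  -- Bounds all loop bounds `n`, `2 * n`, `16 * k` and `2 * t ≤ 4 * n`. The blocks are executed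
  -- separately because none may write its own loop bounds.
  set R := 16 * (n + k) with hR
  set s₀ := (inputStore [n, k, a, b]).setReg 4 1 with hs₀
  have e0 : s₀.reg 0 = n := by simp [hs₀, inputStore]
  have e1 : s₀.reg 1 = k := by simp [hs₀, inputStore]
  have e2 : s₀.reg 2 = a := by simp [hs₀, inputStore]
  have e3 : s₀.reg 3 = b := by simp [hs₀, inputStore]
  have e4 : s₀.reg 4 = 1 := by simp [hs₀]
  have e9 : s₀.reg 9 = 0 := by simp [hs₀, inputStore]
  have em : ∀ a p, s₀.mem a p = 0 := by simp [hs₀, inputStore]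
  set s₁ := sizes.eval s₀ with hs₁
  obtain ⟨f10, f5, f6⟩ := sizes_spec e9
  rw [← hs₁, e0] at f10 f5
  rw [← hs₁, e1] at f6
  have r₁ : ∀ r, r ∉ sizes.writes → s₁.reg r = s₀.reg r := fun r hr => eval_reg_of_notMem hr
  obtain ⟨t, ht, f7, f8, h2, h3⟩ := lengths_spec (s := s₁) (by rw [r₁ 4 (by decide), e4])
    (by rw [r₁ 9 (by decide), e9])
  rw [r₁ 2 (by decide), r₁ 3 (by decide), e2, e3, f10] at h2 h3
  rw [f5] at h2 ht
  rw [f6] at f8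
  set s₂ := lengths.eval s₁ with hs₂
  have r₂ : ∀ r, r ∉ lengths.writes → s₂.reg r = s₁.reg r := fun r hr => eval_reg_of_notMem hr
  have g4 : s₂.reg 4 = 1 := by rw [r₂ 4 (by decide), r₁ 4 (by decide), e4]
  have g5 : s₂.reg 5 = n + n := by rw [r₂ 5 (by decide), f5]
  have g6 : s₂.reg 6 = 16 * k := by rw [r₂ 6 (by decide), f6]
  have g10 : s₂.reg 10 = n := by rw [r₂ 10 (by decide), f10]
  have g9 : s₂.reg 9 = 0 := by rw [r₂ 9 (by decide), r₁ 9 (by decide), e9]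
  obtain ⟨hrows, col, hcol, hsum, hout⟩ := construct_spec g4 g9 g5 g6 f7 g10 (by omega)
    (fun a p => by
      rw [hs₂, eval_mem_of_notMem (by simp [lengths, doublingLoop, mulAdd, memWrites]), hs₁,
        eval_mem_of_notMem (by simp [sizes, memWrites]), em])
  obtain ⟨T₀, hT₀, x₀⟩ := exec_compile (R := R) (c := sizes) (s := s₀) (by decide) (by decide) e4
    (by decide) (by simp [sizes, bounds])
  obtain ⟨T₁, hT₁, x₁⟩ := exec_compile (R := R) (c := lengths) (s := s₁) (by decide) (by decide)
    (by rw [r₁ 4 (by decide), e4]) (by decide) (by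
      have : lengths.bounds = [10, 5, 6] := by decide
      rw [this]
      simp only [List.mem_cons, List.not_mem_nil, or_false, forall_eq_or_imp, forall_eq]
      omega)
  obtain ⟨T₂, hT₂, x₂⟩ := exec_compile (R := R) (c := construct) (s := s₂) (by decide) (by decide)
    g4 (by decide) (by
      intro y hy
      have : ∀ y ∈ construct.bounds, y = 5 ∨ y = 6 ∨ y = 7 ∨ y = 10 := by decide
      rcases this y hy with rfl | rfl | rfl | rfl <;> omega)
  refine ⟨1 + (T₀ + (T₁ + T₂)), t, construct.eval s₂, col, .seq (.const _ 4 1)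
    (.seq x₀ (.seq x₁ x₂)), ?_, h2, h3, by rw [outputRows, hrows, f8], hcol, ?_, hout⟩
  · have hc := hcost R
    simp only [cost] at hc
    calc 1 + (T₀ + (T₁ + T₂)) ≤ 1 + D * (R + 1) ^ e := by omega
      _ ≤ 1 + D * (17 * (n + k)) ^ e := by gcongr; omega
      _ ≤ (17 * (n + k)) ^ e + D * (17 * (n + k)) ^ e := by
          gcongr
          exact Nat.one_le_pow _ _ (by omega)
      _ = _ := by rw [mul_pow]; ring
  · intro j
    have := hsum j
    push_cast at this
    exact this

end RAM

/-! ### Error probability, number of rows and the main theorem. -/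

/-- The number of `k`-sets of columns that cover another column is at most the fraction `δ`. -/
theorem card_filter_le_of_pow_mul_le {n k a b t : ℕ} {δ : ℝ} (hn : 0 < n) (ha : 0 < a)
    (hb : 0 < b) (hδ : (a / b : ℝ) ≤ δ) (ht : t = n + n ∨ b * n ≤ 2 ^ t * a) {B : ℕ}
    (hB : (2 : ℝ) ^ t * B ≤ n * n.choose k) : (B : ℝ) ≤ δ * n.choose k := by
  have ha' : (0 : ℝ) < a := by exact_mod_cast ha
  have hb' : (0 : ℝ) < b := by exact_mod_cast hb
  have hn' : (0 : ℝ) < n := by exact_mod_cast hn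
  have hδ0 : 0 ≤ δ := le_trans (by positivity) hδ
  rcases ht with rfl | ht
  -- At the cap `t = 2 * n` there are no bad sets at all, whatever `δ` is, since `n * 2 ^ n < 2 ^ (2
  -- * n)`.
  · have hzero : B = 0 := by
      by_contra hB0
      have h1 : 1 ≤ B := Nat.one_le_iff_ne_zero.2 hB0
      have h2 : 2 ^ (n + n) * B ≤ n * n.choose k := by exact_mod_cast hB
      have h3 : n * n.choose k < 2 ^ n * 2 ^ n := by
        calc n * n.choose k ≤ n * 2 ^ n := Nat.mul_le_mul_left _ (Nat.choose_le_two_pow n k)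
          _ < _ := Nat.mul_lt_mul_of_pos_right Nat.lt_two_pow_self (by positivity)
      rw [pow_add] at h2
      nlinarith [Nat.mul_le_mul_left (2 ^ n * 2 ^ n) h1]
    rw [hzero]
    simp only [Nat.cast_zero]
    positivity
  · have ht' : (b : ℝ) * n ≤ 2 ^ t * a := by exact_mod_cast ht
    have h1 : (B : ℝ) ≤ a / b * n.choose k := by
      rw [div_mul_eq_mul_div, le_div_iff₀ hb']
      refine le_of_mul_le_mul_left ?_ hn'
      calc (n : ℝ) * (B * b) = (b * n) * B := by ring
        _ ≤ (2 ^ t * a) * B := by gcongr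
        _ = a * (2 ^ t * B) := by ring
        _ ≤ a * (n * n.choose k) := by gcongr
        _ = _ := by ring
    exact h1.trans (by gcongr)

/-- The number of rows. -/
theorem rows_le {n k a b t : ℕ} {δ : ℝ} (hk : 2 ≤ k) (hkn : k ≤ n) (ha : 0 < a) (hb : 0 < b)
    (hδ : (a / b : ℝ) ≤ δ) (hδ2 : δ ≤ 2 * (a / b : ℝ)) (hδ1 : δ < 1)
    (ht : t = 0 ∨ 2 ^ t * a < 2 * (b * n)) :
    ((2 * t * (16 * k) : ℕ) : ℝ) ≤
      160 * (k * (Real.log n / Real.log k) * Real.log (n / δ)) := by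
  have ha' : (0 : ℝ) < a := by exact_mod_cast ha
  have hb' : (0 : ℝ) < b := by exact_mod_cast hb
  have hk' : (2 : ℝ) ≤ k := by exact_mod_cast hk
  have hkn' : (k : ℝ) ≤ n := by exact_mod_cast hkn
  have hδ0 : 0 < δ := lt_of_lt_of_le (by positivity) hδ
  have hn2 : (2 : ℝ) ≤ n / δ := by
    rw [le_div_iff₀ hδ0]
    nlinarith
  have hlog2 : 0.69 < Real.log 2 := lt_trans (by norm_num) Real.log_two_gt_d9
  have hL : Real.log 2 ≤ Real.log (n / δ) := Real.log_le_log (by norm_num) hn2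
  have hlogk : 0 < Real.log k := Real.log_pos (by linarith)
  -- The construction needs only `O(k * log (n / δ))` rows; this factor merely weakens the bound.
  have hratio : 1 ≤ Real.log n / Real.log k := by
    rw [one_le_div hlogk]
    exact Real.log_le_log (by linarith) hkn'
  -- From `2 ^ t ≤ 4 * n / δ` and `log 2 ≤ log (n / δ)` one gets `t * log 2 ≤ 3 * log (n / δ)`, and
  -- `3 / 0.69 < 5`.
  have htL : (t : ℝ) ≤ 5 * Real.log (n / δ) := by
    rcases ht with rfl | ht
    · simp only [Nat.cast_zero]
      linarith
    · have ht' : (2 : ℝ) ^ t * a < 2 * (b * n) := by exact_mod_cast ht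
      have h1 : (2 : ℝ) ^ t ≤ 4 * (n / δ) := by
        rw [← mul_div_assoc, le_div_iff₀ hδ0]
        calc (2 : ℝ) ^ t * δ ≤ 2 ^ t * (2 * (a / b)) := by gcongr
          _ = (2 ^ t * a) * 2 / b := by ring
          _ ≤ (2 * (b * n)) * 2 / b := by gcongr
          _ = 4 * n := by field_simp; ring
      have h2 := Real.log_le_log (by positivity) h1
      rw [Real.log_pow, Real.log_mul (by norm_num) (by positivity),
        show (4 : ℝ) = 2 ^ 2 by norm_num, Real.log_pow] at h2
      push_cast at h2
      have h3 : (t : ℝ) * 0.69 ≤ t * Real.log 2 := by gcongr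
      linarith
  have hL0 : 0 ≤ Real.log (n / δ) := by linarith
  push_cast
  calc 2 * (t : ℝ) * (16 * k) = 32 * k * t := by ring
    _ ≤ 32 * k * (5 * Real.log (n / δ)) := by gcongr
    _ = 160 * (k * 1 * Real.log (n / δ)) := by ring
    _ ≤ _ := by gcongr

theorem mainTheorem6 :
    ∃ (C : ℝ) (D c : ℕ) (P : RAM.Prog), 0 < C ∧
      ∀ (n k a b : ℕ) (δ : ℝ), 2 ≤ k → k ≤ n → 0 < a → 0 < b →
        (a / b : ℝ) ≤ δ → δ ≤ 2 * (a / b : ℝ) → δ < 1 →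
        ∃ (t : ℕ) (s : RAM.Store),
          RAM.Exec P (RAM.inputStore [n, k, a, b]) t s ∧
          t ≤ D * (n + k) ^ c ∧
          (RAM.outputRows s : ℝ) ≤
            C * (k * (Real.log n / Real.log k) * Real.log (n / δ)) ∧
          RecoversRandomSupport (RAM.outputMatrix n s) k δ := by
  classical
  obtain ⟨D, c, h⟩ := RAM.exec_matrixProg
  refine ⟨160, D, c, RAM.matrixProg, by norm_num, fun n k a b δ hk hkn ha hb hδ hδ2 hδ1 => ?_⟩
  obtain ⟨T, t, s, col, hexec, hT, ht, ht', hrows, hcol, hsum, hout⟩ :=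
    h n k a b (by omega) (by omega)
  refine ⟨T, s, hexec, hT, by rw [hrows]; exact rows_le hk hkn ha hb hδ hδ2 hδ1 ht', ?_⟩
  have hentry : ∀ i j, RAM.outputMatrix n s i j =
      if ∃ l < 2 * t, (i : ℕ) = l * (16 * k) + col l j then 1 else 0 := by
    intro i j
    have hiff : (∃ l < 2 * t, ∃ g : Fin n,
        (i : ℕ) * n + j = (l * (16 * k) + col l g) * n + g) ↔
        ∃ l < 2 * t, (i : ℕ) = l * (16 * k) + col l j := by
      constructor
      · rintro ⟨l, hl, g, hp⟩
        rw [RAM.Cmd.mul_add_inj_iff j.2 g.2] at hp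
        obtain rfl : j = g := Fin.ext hp.2
        exact ⟨l, hl, hp.1⟩
      · rintro ⟨l, hl, hi⟩
        exact ⟨l, hl, j, by rw [hi]⟩
    simp only [RAM.outputMatrix, Matrix.of_apply]
    split_ifs with hif
    · rw [(hout _).1 (hiff.2 hif), Nat.cast_one]
    · rw [(hout _).2 (mt hiff.1 hif), Nat.cast_zero]
  set cov : Finset (Fin n) → Prop := fun S => ∃ j, j ∉ S ∧ ∀ l < 2 * t, ∃ i ∈ S, col l i = col l j
  refine recoversRandomSupport_of_disjunct (by omega) hkn _
    (fun i j => by rw [hentry]; split_ifs <;> simp)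
    (((Finset.univ : Finset (Fin n)).powersetCard k).filter fun S => ¬ cov S)
    (Finset.filter_subset _ _) (fun S hS j hj => ?_) ?_
  · have hS' := (Finset.mem_filter.1 hS).2
    simp only [cov, not_exists, not_and, not_forall] at hS'
    obtain ⟨l, hl, hl'⟩ := hS' j hj
    have hlt : l * (16 * k) + col l j < RAM.outputRows s := by
      rw [hrows]
      calc l * (16 * k) + col l j < l * (16 * k) + 16 * k := by have := hcol l hl j; omega
        _ = (l + 1) * (16 * k) := by ring
        _ ≤ _ := Nat.mul_le_mul_right _ hl
    -- The witness is the row of the symbol of `j` at a position `l` where no column of `S` has that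
    -- symbol.
    refine ⟨⟨_, hlt⟩, ?_, fun h hh => ?_⟩
    · rw [hentry, if_pos ⟨l, hl, rfl⟩]
      exact one_ne_zero
    · rw [hentry, if_neg]
      rintro ⟨l', hl', he⟩
      simp only at he
      rw [RAM.Cmd.mul_add_inj_iff (hcol l hl j) (hcol l' hl' h)] at he
      obtain ⟨rfl, he⟩ := he
      exact absurd he.symm (by have := ‹∀ x ∈ S, ¬ col l x = col l j› h hh; exact this)
  · have hbad := card_covered_le (by omega : 0 < k) col hsum
    have hB := card_filter_le_of_pow_mul_le (by omega) ha hb hδ ht hbad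
    have hsplit := Finset.card_filter_add_card_filter_not
      (s := (Finset.univ : Finset (Fin n)).powersetCard k) cov
    rw [Finset.card_powersetCard, Finset.card_univ, Fintype.card_fin] at hsplit
    have hsplit' : ((((Finset.univ : Finset (Fin n)).powersetCard k).filter cov).card : ℝ) +
        (((Finset.univ : Finset (Fin n)).powersetCard k).filter fun S => ¬ cov S).card =
        n.choose k := by exact_mod_cast hsplit
    have hB' : ((((Finset.univ : Finset (Fin n)).powersetCard k).filter cov).card : ℝ) ≤
        δ * n.choose k := by
      convert hB
    linarith
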